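/- Let $G=\mathrm{SL}(3,\mathbb H)$ be the group of quaternionic $3\times3$ matrices of reduced norm $1$. Put $\theta(g)=(g^{-1})^{\dagger}$ and $\sigma(g)=J\,\theta(g)\,J$ with $J=\mathrm{diag}(1,-1,-1)$, and let $K=G^{\theta}=\mathrm{Sp}(3)$ and $H=G^{\sigma}=\mathrm{Sp}(1,2)$. Let $A\subset G$ be the group of diagonal matrices $a_t=\mathrm{diag}(e^{t_1},e^{t_2},e^{t_3})$ with $t\in\mathbb R^3$, $t_1+t_2+t_3=0$, let $\mathfrak a$ be its Lie algebra with Weyl group $W\cong S_3$, and let $\rho(t)=4(t_1-t_3)$ be half the sum of the roots $t_i-t_j$ $(i<j)$, each counted with its multiplicity $4$. A Schwartz function on $G/H$ is a smooth function $\phi:G/H\to\mathbb C$ such that $$\sup_{k\in K}\ \sup_{a\in A}\Big(\sum_{w\in W}a^{w\rho}\Big)\big(1+\|\log a\|\big)^{r}\,\big|(u\phi)(ka H)\big|<\infty$$ for all $r\ge 0$ and all $u\in\mathcal U(\mathfrak g)$, where $u$ acts through the left regular representation. A parabolic subgroup $P$ of $G$, with unipotent radical $N_P$, is called $\sigma$-parabolic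 if $\sigma(P)$ is opposite to $P$. Let $Q_1$ and $Q_4$ be the maximal ($\sigma$-)parabolic subgroups of $G$ that contain $A$ and whose nilradicals are $\mathfrak g_{13}\oplus\mathfrak g_{23}$ and $\mathfrak g_{21}\oplus\mathfrak g_{23}$ respectively, where $\mathfrak g_{ij}$ is the space of matrices supported in the entry $(i,j)$. Integrals over $N_P$ are taken with respect to Haar measure, and a divergent integral of a positive function is one with value $+\infty$. There exists a positive Schwartz function $\phi$ on $G/H$ such that $$(*)\qquad \int_{N_Q}\phi(gn)\,dn\ \text{ is divergent for every } g\in G \text{ and every } Q \text{ that is } H\text{-conjugate to } Q_1 \text{ or } Q_4 .$$ Moreover, for every positive Schwartz function $\phi$ on $G/H$ that satisfies $(*)$, every minimal parabolic subgroup $P$ of $G$ that is $\sigma$-parabolic, and every $g\in G$, the integral $$\int_{N_P}\phi(gn)\,dn$$ is divergent. -/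

import Mathlib

open scoped Quaternion Matrix ContDiff

noncomputable section

namespace SLThreeH

/-! ### The group `G = SL(3,ℍ)` -/

/-- Quaternionic `3 × 3` matrices. -/
abbrev Mat : Type := Matrix (Fin 3) (Fin 3) ℍ[ℝ]

/-- The standard embedding of the quaternions in the complex `2 × 2` matrices:
`a + bi + cj + dk = (a + bi) + (c + di) j` goes to the matrix below. -/
def quatToMat : ℍ[ℝ] →+* Matrix (Fin 2) (Fin 2) ℂ where
  toFun q := !![⟨q.re, q.imI⟩, ⟨q.imJ, q.imK⟩; ⟨-q.imJ, q.imK⟩, ⟨q.re, -q.imI⟩]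
  map_one' := by
    ext i j
    fin_cases i <;> fin_cases j <;> apply Complex.ext <;> simp
  map_zero' := by
    ext i j
    fin_cases i <;> fin_cases j <;> apply Complex.ext <;> simp
  map_add' p q := by
    ext i j
    fin_cases i <;> fin_cases j <;> apply Complex.ext <;> simp <;> ring
  map_mul' p q := by
    ext i j
    fin_cases i <;> fin_cases j <;> apply Complex.ext <;>
      simp [Matrix.mul_apply, Fin.sum_univ_two] <;> ring

theorem quatToMat_star (q : ℍ[ℝ]) : quatToMat (star q) = (quatToMat q)ᴴ := by
  ext i j
  fin_cases i <;> fin_cases j <;> apply Complex.ext <;> simp [quatToMat]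

/-- A quaternionic `3 × 3` matrix as a complex `6 × 6` matrix (in `2 × 2` blocks). -/
def toComplex : Mat →+* Matrix (Fin 3 × Fin 2) (Fin 3 × Fin 2) ℂ :=
  (Matrix.compRingEquiv (Fin 3) (Fin 2) ℂ).toRingHom.comp quatToMat.mapMatrix

theorem toComplex_star (g : Mat) : toComplex (star g) = (toComplex g)ᴴ := by
  ext ⟨i, k⟩ ⟨j, l⟩
  exact congrFun (congrFun (quatToMat_star (g j i)) k) l

/-- The Study determinant (reduced norm) of a quaternionic matrix. -/
def studyDet : Mat →* ℂ where
  toFun g := (toComplex g).det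
  map_one' := by rw [map_one, Matrix.det_one]
  map_mul' g h := by rw [map_mul, Matrix.det_mul]

theorem studyDet_apply (g : Mat) : studyDet g = (toComplex g).det := by
  rfl

theorem studyDet_star (g : Mat) : studyDet (star g) = star (studyDet g) := by
  rw [studyDet_apply, studyDet_apply, toComplex_star, Matrix.det_conjTranspose]

/-- `SL(3,ℍ)` as a subgroup of `GL(3,ℍ)`. -/
def specialLinear : Subgroup Matˣ := (Units.map studyDet).ker

/-- The group `G = SL(3,ℍ)`. As a subspace of the space of matrices it carries its usual
topology. -/
abbrev G : Type := ↥specialLinear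

/-- The underlying matrix of an element of `G`. -/
def G.mat (g : G) : Mat := ((g : Matˣ) : Mat)

theorem mem_specialLinear (g : Matˣ) : g ∈ specialLinear ↔ studyDet (g : Mat) = 1 := by
  rw [specialLinear, MonoidHom.mem_ker, Units.ext_iff]
  rfl

theorem star_mem (g : Matˣ) (hg : g ∈ specialLinear) : star g ∈ specialLinear := by
  rw [mem_specialLinear] at hg ⊢
  rw [Units.coe_star, studyDet_star, hg, star_one]

/-! ### The involutions and the subgroups `K`, `H`, `A` -/

/-- The Cartan involution `θ(g) = (g⁻¹)†`. -/
def theta : G →* G where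
  toFun g := ⟨star (g : Matˣ)⁻¹, star_mem _ (specialLinear.inv_mem g.2)⟩
  map_one' := by ext1; simp
  map_mul' g h := by ext1; simp

/-- The matrix `diag(1,-1,-1)`. -/
def J : Matˣ where
  val := Matrix.diagonal ![1, -1, -1]
  inv := Matrix.diagonal ![1, -1, -1]
  val_inv := by
    rw [Matrix.diagonal_mul_diagonal, ← Matrix.diagonal_one]
    congr 1; funext i; fin_cases i <;> simp
  inv_val := by
    rw [Matrix.diagonal_mul_diagonal, ← Matrix.diagonal_one]
    congr 1; funext i; fin_cases i <;> simp

/-- The involution `σ(g) = J θ(g) J`, where `J = J⁻¹ = diag(1,-1,-1)`. -/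
def sigma : G →* G where
  toFun g := ⟨J * (theta g : Matˣ) * J⁻¹,
    (MonoidHom.normal_ker (Units.map studyDet)).conj_mem _ (theta g).2 J⟩
  map_one' := by ext1; simp
  map_mul' g h := by ext1; simp

/-- `K = Sp(3)`, the fixed group of `θ`. -/
def K : Subgroup G := theta.eqLocus (MonoidHom.id G)

/-- `H = Sp(1,2)`, the fixed group of `σ` (which is connected). -/
def H : Subgroup G := sigma.eqLocus (MonoidHom.id G)

/-- `a = a_t = diag(exp t₁, exp t₂, exp t₃)`. For `a ∈ G` this forces `t₁ + t₂ + t₃ = 0`. -/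
def IsExpDiag (a : G) (t : Fin 3 → ℝ) : Prop :=
  a.mat = Matrix.diagonal fun i => ((Real.exp (t i) : ℝ) : ℍ[ℝ])

/-! ### Parabolic subgroups -/

/-- The conjugate `x P x⁻¹`. -/
def conj (x : G) (P : Subgroup G) : Subgroup G := P.map (MulAut.conj x).toMonoidHom

/-- The standard parabolic subgroup attached to the diagonal matrix `X = diag(w₁,w₂,w₃)`: its Lie
algebra is the sum of the eigenspaces of `ad X` with eigenvalue `≥ 0`, so that it consists of the
`g` whose entries `(i,j)` vanish whenever `wᵢ - wⱼ < 0`. (The condition on `g⁻¹` is a consequence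
of the one on `g`; it is written so that the group axioms are immediate.) These are all the
parabolic subgroups containing the diagonal matrices. -/
def stdParabolic (w : Fin 3 → ℝ) : Subgroup G where
  carrier := {g | ∀ i j, w i < w j → g.mat i j = 0 ∧ (g⁻¹).mat i j = 0}
  one_mem' := by
    intro i j h
    have hij : i ≠ j := by rintro rfl; exact lt_irrefl _ h
    have h1 : (1 : G).mat = 1 := rfl
    simp [h1, Matrix.one_apply_ne hij]
  inv_mem' := by
    intro g hg i j h
    rw [inv_inv]
    exact (hg i j h).symm
  mul_mem' := by
    intro g h hg hh i j hij
    have key : ∀ a b : Mat, (∀ i j, w i < w j → a i j = 0) → (∀ i j, w i < w j → b i j = 0) →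
        (a * b) i j = 0 := by
      intro a b ha hb
      rw [Matrix.mul_apply]
      refine Finset.sum_eq_zero fun k _ => ?_
      rcases lt_or_ge (w i) (w k) with h1 | h1
      · rw [ha i k h1, zero_mul]
      · rw [hb k j (h1.trans_lt hij), mul_zero]
    refine ⟨key g.mat h.mat (fun i j l => (hg i j l).1) (fun i j l => (hh i j l).1), ?_⟩
    rw [mul_inv_rev]
    exact key (h⁻¹).mat (g⁻¹).mat (fun i j l => (hh i j l).2) (fun i j l => (hg i j l).2)

/-- A parabolic subgroup of `G` is a conjugate of a standard one. -/
def IsParabolic (P : Subgroup G) : Prop := ∃ (x : G) (w : Fin 3 → ℝ), P = conj x (stdParabolic w)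

/-- Two parabolic subgroups are opposite: up to a simultaneous conjugation they are the standard
parabolic subgroups of `X` and of `-X`; equivalently, their intersection is a Levi subgroup of
both. -/
def AreOpposite (P P' : Subgroup G) : Prop :=
  ∃ (x : G) (w : Fin 3 → ℝ), P = conj x (stdParabolic w) ∧ P' = conj x (stdParabolic (-w))

/-- A `σ`-parabolic subgroup is a parabolic subgroup `P` that is opposite to `σ(P)`. -/
def IsSigmaParabolic (P : Subgroup G) : Prop := IsParabolic P ∧ AreOpposite P (P.map sigma)

/-- The set `𝒫_σ` of minimal `σ`-parabolic subgroups: the minimal parabolic subgroups of `G` that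
are `σ`-parabolic. -/
def minimalSigmaParabolics : Set (Subgroup G) :=
  {P | Minimal IsParabolic P ∧ IsSigmaParabolic P}

/-- The unipotent radical `N_P`: the largest normal subgroup of `P` that consists of unipotent
matrices. -/
def unipotentRadical (P : Subgroup G) : Subgroup G :=
  sSup {U | U ≤ P ∧ (∀ p ∈ P, ∀ u ∈ U, p * u * p⁻¹ ∈ U) ∧ ∀ u ∈ U, IsNilpotent (G.mat u - 1)}

/-- The maximal parabolic subgroup with nilradical `𝔤₁₃ ⊕ 𝔤₂₃`. -/
def Q₁ : Subgroup G := stdParabolic ![1, 1, 0]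

/-- The maximal parabolic subgroup with nilradical `𝔤₂₁ ⊕ 𝔤₂₃`. -/
def Q₄ : Subgroup G := stdParabolic ![0, 1, 0]

/-! ### Schwartz functions on `G/H` -/

/-- A function on `G` is smooth: locally it is the restriction of a smooth function on an open
set of matrices (`G` is a closed embedded submanifold of the space of matrices). -/
def IsSmooth (f : G → ℂ) : Prop :=
  ∀ g : G, ∃ (U : Set (Fin 3 → Fin 3 → ℍ[ℝ])) (F : (Fin 3 → Fin 3 → ℍ[ℝ]) → ℂ),
    IsOpen U ∧ (fun i j => g.mat i j) ∈ U ∧ ContDiffOn ℝ ∞ F U ∧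
      ∀ x : G, (fun i j => x.mat i j) ∈ U → f x = F (fun i j => x.mat i j)

/-- The Lie algebra `𝔤` of `G`: the matrices that generate a one-parameter subgroup of `G`. -/
def lieAlg : Set Mat := {X | ∀ t : ℝ, ∃ g : G, g.mat = NormedSpace.exp (t • X)}

/-- The element `exp (tX)` of `G`, for `X ∈ 𝔤`. -/
def oneParam (X : lieAlg) (t : ℝ) : G := (X.2 t).choose

/-- The derivative of the left regular representation: `(Xf)(g) = d/dt f(exp(-tX) g)` at `t = 0`. -/
def lieDeriv (X : lieAlg) (f : G → ℂ) (g : G) : ℂ :=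
  deriv (fun t : ℝ => f (oneParam X (-t) * g)) 0

/-- The action of the product `X₁ X₂ ⋯ Xₙ` in the universal enveloping algebra. -/
def wordDeriv (u : List lieAlg) (f : G → ℂ) : G → ℂ := u.foldr lieDeriv f

/-- Half the sum `(1/2) tr (ad Y | 𝔫)` of the positive roots `tᵢ - tⱼ`, `i < j`, counted with
their multiplicities `dim 𝔤ᵢⱼ = dim ℍ = 4`, for the minimal `σ`-parabolic subgroup of upper
triangular matrices. -/
def rho (t : Fin 3 → ℝ) : ℝ :=
  (1 / 2) * (4 * (t 0 - t 1) + 4 * (t 0 - t 2) + 4 * (t 1 - t 2))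

/-- The weight `∑_{w ∈ W} a^{wρ}` at `a = a_t`; the Weyl group is the symmetric group. -/
def weight (t : Fin 3 → ℝ) : ℝ := ∑ w : Equiv.Perm (Fin 3), Real.exp (rho (t ∘ w))

/-- Schwartz functions on `G/H`. As the products of elements of `𝔤` span the universal enveloping
algebra, finiteness of the seminorms for all its elements is finiteness for these products. -/
def IsSchwartz (φ : G ⧸ H → ℂ) : Prop :=
  IsSmooth (fun g => φ (g : G ⧸ H)) ∧
    ∀ (u : List lieAlg) (r : ℝ), 0 ≤ r → ∃ C : ℝ, ∀ k ∈ K, ∀ (a : G) (t : Fin 3 → ℝ),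
      IsExpDiag a t →
        weight t * (1 + √(∑ i, t i ^ 2)) ^ r *
          ‖wordDeriv u (fun g => φ (g : G ⧸ H)) (k * a)‖ ≤ C

/-- `φ` takes positive real values. -/
def IsPositive (φ : G ⧸ H → ℂ) : Prop := ∀ x, 0 < (φ x).re ∧ (φ x).im = 0

/-- The integral `∫_N φ(gn) dn` of the (positive) function `φ` with respect to Haar measure on `N`
diverges, i.e. is infinite. Haar measure being unique up to scaling, this is required for each. -/
def IntegralDiverges (φ : G ⧸ H → ℂ) (N : Subgroup G) (g : G) : Prop :=
  letI : MeasurableSpace N := borel N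
  ∀ μ : MeasureTheory.Measure N, μ.IsHaarMeasure →
    ∫⁻ n : N, ‖φ ((g * (n : G) : G) : G ⧸ H)‖ₑ ∂μ = ⊤

/-- `φ` is a positive Schwartz function on `G/H` such that for each `Q` that is `H`-conjugate
to `Q₁` or to `Q₄` and for each `g` the integral of `φ(gn)` over `N_Q` diverges. (Such `Q` are
automatically maximal `σ`-parabolic subgroups.) -/
def IsDivergentSchwartz (φ : G ⧸ H → ℂ) : Prop :=
  IsSchwartz φ ∧ IsPositive φ ∧
    ∀ Q : Subgroup G, (∃ h ∈ H, Q = conj h Q₁ ∨ Q = conj h Q₄) →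
      ∀ g : G, IntegralDiverges φ (unipotentRadical Q) g

end SLThreeH

end

/-!
The map `gH ↦ Y = g J g†` embeds `G/H` in the space of hermitian matrices, and on `KA` the function
`size = ‖Y‖² ‖Y⁻¹‖²` is comparable with the weight `∑ a^{wρ}`. The witness is `size ^ (-7/6)`.

*Decay.* Since `Y` and `Y⁻¹` move linearly under `G`, the quotients of quadratic forms in `Y` by
`‖Y‖²`, and likewise for `Y⁻¹`, generate an algebra of bounded functions that is stable under the
left regular representation of the Lie algebra. All derivatives of the witness are products of the
witness with elements of this algebra (`exists_wordDeriv_eq`), so that only the witness itself has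
to be estimated on `KA`, where the surplus `size ^ (-1/6)` absorbs every power of `1 + ‖log a‖`
(`exists_weight_mul_sizePow_le`).

*Divergence.* The unipotent radicals of `Q₁` and `Q₄` are isomorphic to `ℍ²`. In coordinates
`(x, y)`, one of `Y`, `Y⁻¹` grows quadratically, but the other one only linearly near the cone
`‖x‖ = ‖y‖`: on the region `‖x‖ ≤ ‖y‖ < ‖x‖ + 1` the size is `O((1 + ‖x‖)⁶)`. The slice of this
region at `x` has volume at least a multiple of `(1 + ‖x‖)³`, and the integral of
`(1 + ‖x‖)^(-7 + 3)` over `ℍ = ℝ⁴` diverges (`lintegral_eq_top_of_le`). The size changes at most by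
a bounded factor under left translations, which takes care of the translates by `g`.

*Minimal parabolic subgroups.* If `P = y P_v y⁻¹` is minimal and `σ(P) = y P_{-v} y⁻¹`, then
`y⁻¹ σ(y)` normalizes `P_{-v}` and `y⁻¹ J (y⁻¹)†` is diagonal. After rescaling it is `diag(±1)`,
with one positive sign by the law of inertia, and a permutation makes it equal to `J`. Hence `P` is
conjugate under `H` to some `P_w` with `w₂ < w₁` (`exists_conj_stdParabolic_of_mem`). Its
unipotent radical is a semidirect product of one root group and the unipotent radical of `Q₁` or of
`Q₄`, and the divergence is inherited by Tonelli's theorem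
(`IsRootExtension.integralDiverges`). Uniqueness of Haar measure allows one to compute with left
invariant measures in coordinates, and unipotent radicals are determined in
`unipotentRadical_stdParabolic`.
-/

noncomputable section

namespace SLThreeH

/-! ### Matrices of elements of `G` -/

@[simp] theorem G.mat_one : (1 : G).mat = 1 := rfl

@[simp] theorem G.mat_mul (g h : G) : (g * h).mat = g.mat * h.mat := rfl

@[simp] theorem G.mat_mul_mat_inv (g : G) : g.mat * (g⁻¹).mat = 1 := by
  rw [← G.mat_mul, mul_inv_cancel, G.mat_one]

@[simp] theorem G.mat_inv_mul_mat (g : G) : (g⁻¹).mat * g.mat = 1 := by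
  rw [← G.mat_mul, inv_mul_cancel, G.mat_one]

@[simp] theorem G.mat_mul_mat_inv_mul (g : G) (A : Mat) : g.mat * ((g⁻¹).mat * A) = A := by
  rw [← mul_assoc, G.mat_mul_mat_inv, one_mul]

@[simp] theorem G.mat_inv_mul_mat_mul (g : G) (A : Mat) : (g⁻¹).mat * (g.mat * A) = A := by
  rw [← mul_assoc, G.mat_inv_mul_mat, one_mul]

theorem G.mat_injective : Function.Injective G.mat := fun _ _ h =>
  Subtype.ext (Units.ext h)

theorem G.mat_inv_eq {g : G} {B : Mat} (h : g.mat * B = 1) : (g⁻¹).mat = B := by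
  rw [← mul_one (g⁻¹).mat, ← h, G.mat_inv_mul_mat_mul]

theorem G.studyDet_mat (g : G) : studyDet g.mat = 1 := (mem_specialLinear _).1 g.2

@[simp] theorem J_mul_J : (J : Mat) * (J : Mat) = 1 := J.mul_inv

@[simp] theorem J_mul_J_mul (A : Mat) : (J : Mat) * ((J : Mat) * A) = A := by
  rw [← mul_assoc, J_mul_J, one_mul]

theorem J_val : (J : Mat) = Matrix.diagonal ![1, -1, -1] := rfl

@[simp] theorem star_J : star (J : Mat) = J := by
  rw [J_val, Matrix.star_eq_conjTranspose, Matrix.diagonal_conjTranspose]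
  congr 1; funext i; fin_cases i <;> simp

theorem mat_theta (g : G) : (theta g).mat = star (g⁻¹).mat := rfl

theorem mat_sigma (g : G) : (sigma g).mat = (J : Mat) * star (g⁻¹).mat * J := rfl

theorem mem_K_iff (g : G) : g ∈ K ↔ star (g⁻¹).mat = g.mat := by
  rw [← mat_theta]
  exact ⟨fun h => congrArg G.mat h, fun h => G.mat_injective h⟩

theorem mem_H_iff (g : G) : g ∈ H ↔ (J : Mat) * star (g⁻¹).mat * J = g.mat := by
  rw [← mat_sigma]
  exact ⟨fun h => congrArg G.mat h, fun h => G.mat_injective h⟩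

/-- `H` is the stabilizer of `J` for the action `g ↦ g J g†` on hermitian matrices. -/
theorem mem_H_iff' (g : G) : g ∈ H ↔ g.mat * J * star g.mat = J := by
  have hs : star (g⁻¹).mat * star g.mat = 1 := by rw [← star_mul, G.mat_mul_mat_inv, star_one]
  have hs' : star g.mat * star (g⁻¹).mat = 1 := by rw [← star_mul, G.mat_inv_mul_mat, star_one]
  rw [mem_H_iff]
  constructor
  · intro h
    have h2 : g.mat * (J : Mat) = J * star (g⁻¹).mat := by
      rw [← h, mul_assoc, J_mul_J, mul_one]
    rw [h2, mul_assoc, hs, mul_one]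
  · intro h
    have h2 : g.mat * (J : Mat) = J * star (g⁻¹).mat := by
      rw [← mul_one (g.mat * (J : Mat)), ← hs', ← mul_assoc, h]
    rw [← h2, mul_assoc, J_mul_J, mul_one]

/-- An element of `G` given by a matrix and its inverse. -/
def mkG (A B : Mat) (hAB : A * B = 1) (hBA : B * A = 1) (hA : studyDet A = 1) : G :=
  ⟨⟨A, B, hAB, hBA⟩, (mem_specialLinear _).2 hA⟩

/-! ### Elements of reduced norm one -/

theorem toComplex_apply (A : Mat) (i j : Fin 3) (k l : Fin 2) :
    toComplex A (i, k) (j, l) = quatToMat (A i j) k l := rfl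

theorem det_one_add_of_isNilpotent {n : Type*} [Fintype n] [DecidableEq n] {A : Matrix n n ℂ}
    (hA : IsNilpotent A) : (1 + A).det = 1 := by
  have h2 := (Matrix.isNilpotent_charpoly_sub_pow_of_isNilpotent hA.neg).eq_zero
  have h4 := congrArg (Polynomial.eval 1) (sub_eq_zero.1 h2)
  rw [Matrix.eval_charpoly] at h4
  simpa using h4

theorem studyDet_one_add_of_isNilpotent {A : Mat} (hA : IsNilpotent A) :
    studyDet (1 + A) = 1 := by
  rw [studyDet_apply, map_add, map_one]
  exact det_one_add_of_isNilpotent (hA.map toComplex)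

/-- The real part of the trace of a quaternionic matrix. -/
def reTrace (A : Mat) : ℝ := ∑ i, (A i i).re

theorem trace_toComplex (A : Mat) : (toComplex A).trace = ((2 * reTrace A : ℝ) : ℂ) := by
  rw [Matrix.trace, Fintype.sum_prod_type, reTrace]
  apply Complex.ext
  · simp [toComplex_apply, quatToMat, Fin.sum_univ_three]
    ring
  · simp [toComplex_apply, quatToMat, Fin.sum_univ_three]

theorem reTrace_add (A B : Mat) : reTrace (A + B) = reTrace A + reTrace B := by
  simp [reTrace, Finset.sum_add_distrib]

theorem reTrace_sub (A B : Mat) : reTrace (A - B) = reTrace A - reTrace B := by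
  simp [reTrace, Finset.sum_sub_distrib]

theorem reTrace_eq_zero_of_isNilpotent {A : Mat} (hA : IsNilpotent A) : reTrace A = 0 := by
  have h1 := (Matrix.isNilpotent_trace_of_isNilpotent (hA.map toComplex)).eq_zero
  rw [trace_toComplex] at h1
  have := Complex.ofReal_eq_zero.1 h1
  linarith

theorem single_mul_single_self {i j : Fin 3} (h : i ≠ j) (p q : ℍ[ℝ]) :
    (Matrix.single i j p : Mat) * Matrix.single i j q = 0 :=
  Matrix.single_mul_single_of_ne _ _ _ _ h.symm _

/-- The elementary unipotent element `1 + q Eᵢⱼ` of `G`. -/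
def elem (i j : Fin 3) (h : i ≠ j) (q : ℍ[ℝ]) : G :=
  mkG (1 + Matrix.single i j q) (1 - Matrix.single i j q)
    (by rw [mul_sub, add_mul _ _ (Matrix.single i j q), single_mul_single_self h]; simp)
    (by rw [mul_add, sub_mul _ _ (Matrix.single i j q), single_mul_single_self h]; simp)
    (studyDet_one_add_of_isNilpotent ⟨2, by rw [sq, single_mul_single_self h]⟩)

theorem elem_mat {i j : Fin 3} (h : i ≠ j) (q : ℍ[ℝ]) :
    (elem i j h q).mat = 1 + Matrix.single i j q := rfl

theorem elem_inv_mat {i j : Fin 3} (h : i ≠ j) (q : ℍ[ℝ]) :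
    ((elem i j h q)⁻¹).mat = 1 - Matrix.single i j q := rfl

theorem studyDet_diagonal (d : Fin 3 → ℝ) :
    studyDet (Matrix.diagonal fun i => ((d i : ℝ) : ℍ[ℝ])) = ((∏ i, d i ^ 2 : ℝ) : ℂ) := by
  have h : toComplex (Matrix.diagonal fun i => ((d i : ℝ) : ℍ[ℝ])) =
      Matrix.diagonal fun x : Fin 3 × Fin 2 => ((d x.1 : ℝ) : ℂ) := by
    ext ⟨i, k⟩ ⟨j, l⟩
    rw [toComplex_apply]
    by_cases hij : i = j
    · subst hij
      fin_cases k <;> fin_cases l <;> apply Complex.ext <;> simp [quatToMat]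
    · rw [Matrix.diagonal_apply_ne _ hij, Matrix.diagonal_apply_ne _ (by simp [hij])]
      simp
  rw [studyDet_apply, h, Matrix.det_diagonal, Fintype.prod_prod_type]
  simp [sq]

/-- The permutation matrix with entries `δ_{π i, j}` as an element of `G`: its reduced norm is the
square of the sign. -/
def permElem (π : Equiv.Perm (Fin 3)) : G :=
  mkG (Matrix.of fun i j => if π i = j then 1 else 0) (Matrix.of fun i j => if π j = i then 1 else 0)
    (Matrix.ext fun i j => by simp [Matrix.mul_apply, Matrix.one_apply, eq_comm])
    (Matrix.ext fun i j => by
      simp only [Matrix.mul_apply, Matrix.of_apply, mul_ite, mul_one, mul_zero, Matrix.one_apply]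
      rw [Finset.sum_eq_single (π.symm j)]
      · simp [eq_comm]
      · intro b _ hb
        rw [if_neg]
        rintro rfl
        simp at hb
      · simp)
    (by
      have h : toComplex (Matrix.of fun i j => if π i = j then 1 else 0) =
          Equiv.Perm.permMatrix ℂ (Equiv.prodCongr π (Equiv.refl (Fin 2))) := by
        ext ⟨i, k⟩ ⟨j, l⟩
        rw [toComplex_apply, Equiv.Perm.permMatrix, PEquiv.toMatrix_apply]
        by_cases hij : π i = j
        · fin_cases k <;> fin_cases l <;> apply Complex.ext <;> simp [quatToMat, hij]
        · simp [hij]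
      have hs : ∀ π : Equiv.Perm (Fin 3),
          Equiv.Perm.sign (Equiv.prodCongr π (Equiv.refl (Fin 2)) : Equiv.Perm _) = 1 := by decide
      rw [studyDet_apply, h, Matrix.det_permutation, hs]
      simp)

theorem permElem_mat_apply (π : Equiv.Perm (Fin 3)) (i j : Fin 3) :
    (permElem π).mat i j = if π i = j then 1 else 0 := rfl

theorem permElem_inv_mat_apply (π : Equiv.Perm (Fin 3)) (i j : Fin 3) :
    ((permElem π)⁻¹).mat i j = if π j = i then 1 else 0 := rfl

theorem permElem_mul_mul_inv (π : Equiv.Perm (Fin 3)) (A : Mat) (i j : Fin 3) :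
    ((permElem π).mat * A * ((permElem π)⁻¹).mat) i j = A (π i) (π j) := by
  simp [Matrix.mul_apply, permElem_mat_apply, permElem_inv_mat_apply]

theorem star_permElem_mat (π : Equiv.Perm (Fin 3)) :
    star (permElem π).mat = ((permElem π)⁻¹).mat := by
  refine Matrix.ext fun i j => ?_
  rw [Matrix.star_apply, permElem_mat_apply, permElem_inv_mat_apply]
  split_ifs <;> simp

/-! ### Unipotent radicals of the standard parabolic subgroups -/

theorem elem_mem_stdParabolic {w : Fin 3 → ℝ} {i j : Fin 3} (h : i ≠ j) (hw : w j ≤ w i)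
    (q : ℍ[ℝ]) : elem i j h q ∈ stdParabolic w := by
  intro k l hkl
  have h1 : k ≠ l := by rintro rfl; exact lt_irrefl _ hkl
  have h2 : (Matrix.single i j q : Mat) k l = 0 := by
    rw [Matrix.single_apply, if_neg]
    rintro ⟨rfl, rfl⟩
    exact absurd hkl (not_lt.2 hw)
  rw [elem_mat, elem_inv_mat, Matrix.add_apply, Matrix.sub_apply, h2, Matrix.one_apply_ne h1]
  simp

/-- The matrices in the sum of the eigenspaces of `ad (diag w)` with positive eigenvalue. -/
def StrictlyUpper (w : Fin 3 → ℝ) (A : Mat) : Prop := ∀ i j, w i ≤ w j → A i j = 0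

theorem StrictlyUpper.add {w : Fin 3 → ℝ} {A B : Mat} (hA : StrictlyUpper w A)
    (hB : StrictlyUpper w B) : StrictlyUpper w (A + B) := fun i j h => by
  rw [Matrix.add_apply, hA i j h, hB i j h, add_zero]

theorem StrictlyUpper.neg {w : Fin 3 → ℝ} {A : Mat} (hA : StrictlyUpper w A) :
    StrictlyUpper w (-A) := fun i j h => by
  rw [Matrix.neg_apply, hA i j h, neg_zero]

theorem StrictlyUpper.mul {w : Fin 3 → ℝ} {A B : Mat} (hA : StrictlyUpper w A)
    (hB : StrictlyUpper w B) : StrictlyUpper w (A * B) := fun i j h => by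
  rw [Matrix.mul_apply]
  refine Finset.sum_eq_zero fun k _ => ?_
  rcases le_or_gt (w i) (w k) with h1 | h1
  · rw [hA i k h1, zero_mul]
  · rw [hB k j (h1.le.trans h), mul_zero]

theorem StrictlyUpper.mul_mul_self {w : Fin 3 → ℝ} {A : Mat} (hA : StrictlyUpper w A) :
    A * (A * A) = 0 := by
  refine Matrix.ext fun i j => ?_
  rw [Matrix.mul_apply]
  refine Finset.sum_eq_zero fun k _ => ?_
  rcases le_or_gt (w i) (w k) with h1 | h1
  · rw [hA i k h1, zero_mul]
  rw [Matrix.mul_apply, Finset.sum_eq_zero, mul_zero]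
  intro l _
  rcases le_or_gt (w k) (w l) with h2 | h2
  · rw [hA k l h2, zero_mul]
  rcases le_or_gt (w l) (w j) with h3 | h3
  · rw [hA l j h3, mul_zero]
  -- four distinct values of `w` on three indices
  have key : ∀ i k l j : Fin 3, i ≠ k → i ≠ l → i ≠ j → k ≠ l → k ≠ j → l ≠ j → False := by
    intro i k l j
    omega
  refine (key i k l j ?_ ?_ ?_ ?_ ?_ ?_).elim <;> rintro rfl <;> linarith

/-- The unipotent group `1 + (sum of the positive eigenspaces of ad (diag w))`. -/
def stdRadical (w : Fin 3 → ℝ) : Subgroup G where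
  carrier := {g | StrictlyUpper w (g.mat - 1)}
  one_mem' := fun i j _ => by simp
  mul_mem' := by
    intro g h hg hh
    have e : (g * h).mat - 1 = (g.mat - 1) * (h.mat - 1) + ((g.mat - 1) + (h.mat - 1)) := by
      rw [G.mat_mul]; noncomm_ring
    change StrictlyUpper w _
    rw [e]
    exact (StrictlyUpper.mul hg hh).add (StrictlyUpper.add hg hh)
  inv_mem' := by
    intro g hg
    have e : (g⁻¹).mat = 1 + (-(g.mat - 1) + (g.mat - 1) * (g.mat - 1)) := by
      apply G.mat_inv_eq
      have h3 := StrictlyUpper.mul_mul_self hg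
      calc g.mat * (1 + (-(g.mat - 1) + (g.mat - 1) * (g.mat - 1)))
          = 1 + (g.mat - 1) * ((g.mat - 1) * (g.mat - 1)) := by noncomm_ring
        _ = 1 := by rw [h3, add_zero]
    change StrictlyUpper w _
    rw [e, add_sub_cancel_left]
    exact (StrictlyUpper.neg hg).add (StrictlyUpper.mul hg hg)

theorem mem_stdRadical {w : Fin 3 → ℝ} {g : G} :
    g ∈ stdRadical w ↔ ∀ i j, w i ≤ w j → g.mat i j = (1 : Mat) i j := by
  refine forall₃_congr fun i j _ => ?_
  rw [Matrix.sub_apply, sub_eq_zero]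

theorem stdRadical_le_stdParabolic (w : Fin 3 → ℝ) : stdRadical w ≤ stdParabolic w := by
  intro g hg i j h
  have hij : i ≠ j := by rintro rfl; exact lt_irrefl _ h
  rw [mem_stdRadical.1 hg i j h.le, mem_stdRadical.1 (inv_mem hg) i j h.le,
    Matrix.one_apply_ne hij]
  exact ⟨rfl, rfl⟩

theorem conj_mem_stdRadical {w : Fin 3 → ℝ} {p u : G} (hp : p ∈ stdParabolic w)
    (hu : u ∈ stdRadical w) : p * u * p⁻¹ ∈ stdRadical w := by
  have e : (p * u * p⁻¹).mat - 1 = p.mat * (u.mat - 1) * (p⁻¹).mat := by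
    rw [G.mat_mul, G.mat_mul, mul_sub, sub_mul, mul_one, G.mat_mul_mat_inv]
  intro i j hij
  rw [e, Matrix.mul_apply]
  refine Finset.sum_eq_zero fun l _ => ?_
  rcases lt_or_ge (w l) (w j) with h1 | h1
  · rw [(hp l j h1).2, mul_zero]
  rw [Matrix.mul_apply, Finset.sum_eq_zero, zero_mul]
  intro k _
  rcases lt_or_ge (w i) (w k) with h2 | h2
  · rw [(hp i k h2).1, zero_mul]
  · rw [hu k l (h2.trans (hij.trans h1)), mul_zero]

theorem mul_single_mul_single (A : Mat) (i j : Fin 3) (q : ℍ[ℝ]) :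
    reTrace (A * Matrix.single i j q * (A * Matrix.single i j q)) =
      (A j i * q * (A j i * q)).re := by
  have h : ∀ k l, (A * Matrix.single i j q) k l = if l = j then A k i * q else 0 := by
    intro k l
    split_ifs with hl
    · rw [hl, Matrix.mul_single_apply_same]
    · rw [Matrix.mul_single_apply_of_ne _ _ _ _ _ hl]
  simp only [reTrace, Matrix.mul_apply (M := A * Matrix.single i j q), h, mul_ite, ite_mul,
    mul_zero, zero_mul]
  rw [Finset.sum_eq_single j, Finset.sum_eq_single j]
  · simp only [if_true]
  · intro k _ hk
    rw [if_neg hk]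
    simp
  · simp
  · intro k _ hk
    simp [hk]
  · simp

/-- Off the diagonal, the Levi part of a normal unipotent subgroup of a parabolic vanishes.
If `1 + n` and `p (1 + n) p⁻¹` lie in such a subgroup, so does their product, and unipotent elements
have the trace of the identity; therefore `Re tr (n p n p⁻¹) = 0`. For `p = 1 ± q Eᵢⱼ` this gives
`Re (nⱼᵢ q nⱼᵢ q) = 0`, and one takes for `q` the conjugate of `nⱼᵢ`. -/
theorem apply_eq_zero_of_normal_unipotent {w : Fin 3 → ℝ} {U : Subgroup G}
    (hn : ∀ p ∈ stdParabolic w, ∀ u ∈ U, p * u * p⁻¹ ∈ U)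
    (hu : ∀ u ∈ U, IsNilpotent (G.mat u - 1)) {u : G} (huU : u ∈ U) {i j : Fin 3} (hij : i ≠ j)
    (hw : w i = w j) : u.mat j i = 0 := by
  set n : Mat := u.mat - 1 with hn_def
  have key : ∀ q : ℍ[ℝ], reTrace (n * ((1 + Matrix.single i j q) * n *
      (1 - Matrix.single i j q))) = 0 := by
    intro q
    set p := elem i j hij q
    have hp : p * u * p⁻¹ ∈ U := hn p (elem_mem_stdParabolic hij hw.ge q) u huU
    have h1 : p.mat * n * (p⁻¹).mat = (p * u * p⁻¹).mat - 1 := by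
      rw [G.mat_mul, G.mat_mul, mul_sub, sub_mul, mul_one, G.mat_mul_mat_inv]
    have h2 : n * (p.mat * n * (p⁻¹).mat) =
        ((u * (p * u * p⁻¹)).mat - 1) - n - ((p * u * p⁻¹).mat - 1) := by
      rw [h1, G.mat_mul u, hn_def]; noncomm_ring
    change reTrace (n * (p.mat * n * (p⁻¹).mat)) = 0
    rw [h2, reTrace_sub, reTrace_sub, reTrace_eq_zero_of_isNilpotent (hu _ (mul_mem huU hp)),
      reTrace_eq_zero_of_isNilpotent (hu _ huU), reTrace_eq_zero_of_isNilpotent (hu _ hp)]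
    simp
  set q := star (n j i) with hq
  have h0 := key 0
  have h1 := key q
  have h2 := key (-q)
  have e : n * ((1 + Matrix.single i j q) * n * (1 - Matrix.single i j q)) +
      n * ((1 + Matrix.single i j (-q)) * n * (1 - Matrix.single i j (-q))) =
      n * ((1 + Matrix.single i j 0) * n * (1 - Matrix.single i j 0)) +
      n * ((1 + Matrix.single i j 0) * n * (1 - Matrix.single i j 0)) -
      (n * Matrix.single i j q * (n * Matrix.single i j q) +
      n * Matrix.single i j q * (n * Matrix.single i j q)) := by
    rw [← Matrix.single_neg, Matrix.single_zero]
    noncomm_ring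
  have e2 := congrArg reTrace e
  rw [reTrace_add, reTrace_sub, reTrace_add, reTrace_add, h0, h1, h2, mul_single_mul_single, hq,
    Quaternion.self_mul_star, ← Quaternion.coe_mul, Quaternion.re_coe] at e2
  have h3 : Quaternion.normSq (n j i) = 0 := by
    have : Quaternion.normSq (n j i) * Quaternion.normSq (n j i) = 0 := by linarith
    exact mul_self_eq_zero.1 this
  have h4 : n j i = 0 := Quaternion.normSq_eq_zero.1 h3
  rwa [hn_def, Matrix.sub_apply, Matrix.one_apply_ne hij.symm, sub_zero] at h4

theorem pow_apply_of_triangular {w : Fin 3 → ℝ} {A : Mat}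
    (hA : ∀ i j, i ≠ j → w i ≤ w j → A i j = 0) (m : ℕ) :
    (∀ i j, i ≠ j → w i ≤ w j → (A ^ m) i j = 0) ∧ ∀ i, (A ^ m) i i = A i i ^ m := by
  induction m with
  | zero => exact ⟨fun i j h _ => by rw [pow_zero, Matrix.one_apply_ne h], fun i => by simp⟩
  | succ m ih =>
    constructor
    · intro i j hij hw
      rw [pow_succ, Matrix.mul_apply]
      refine Finset.sum_eq_zero fun k _ => ?_
      by_cases h1 : i ≠ k ∧ w i ≤ w k
      · rw [ih.1 i k h1.1 h1.2, zero_mul]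
      rw [hA k j, mul_zero]
      · rintro rfl; exact h1 ⟨hij, hw⟩
      · by_cases h2 : i = k
        · rwa [← h2]
        · exact (lt_of_not_ge fun h3 => h1 ⟨h2, h3⟩).le.trans hw
    · intro i
      rw [pow_succ, Matrix.mul_apply, Finset.sum_eq_single i, ih.2, pow_succ]
      · intro k _ hk
        rcases le_total (w i) (w k) with h | h
        · rw [ih.1 i k hk.symm h, zero_mul]
        · rw [hA k i hk h, mul_zero]
      · simp

theorem unipotentRadical_stdParabolic (w : Fin 3 → ℝ) :
    unipotentRadical (stdParabolic w) = stdRadical w := by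
  apply le_antisymm
  · refine sSup_le ?_
    rintro U ⟨hU, hn, hu⟩ u huU
    have h1 : ∀ i j, i ≠ j → w i ≤ w j → (u.mat - 1) i j = 0 := by
      intro i j hij hw
      rw [Matrix.sub_apply, Matrix.one_apply_ne hij, sub_zero]
      rcases hw.lt_or_eq with h | h
      · exact (hU huU i j h).1
      · exact apply_eq_zero_of_normal_unipotent hn hu huU hij.symm h.symm
    intro i j hw
    by_cases hij : i = j
    · subst hij
      obtain ⟨m, hm⟩ := hu u huU
      have h2 := (pow_apply_of_triangular h1 m).2 i
      rw [hm, Matrix.zero_apply] at h2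
      exact eq_zero_of_pow_eq_zero h2.symm
    · exact h1 i j hij hw
  · exact le_sSup ⟨stdRadical_le_stdParabolic w, fun p hp u hu => conj_mem_stdRadical hp hu,
      fun u hu => ⟨3, by rw [pow_succ', sq]; exact StrictlyUpper.mul_mul_self hu⟩⟩

/-! ### Conjugation -/

theorem mem_conj {x g : G} {P : Subgroup G} : g ∈ conj x P ↔ x⁻¹ * g * x ∈ P := by
  rw [conj, Subgroup.mem_map_equiv]
  simp [mul_assoc]

theorem conj_conj (x y : G) (P : Subgroup G) : conj x (conj y P) = conj (x * y) P := by
  ext g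
  simp [mem_conj, mul_assoc]

@[simp] theorem conj_one (P : Subgroup G) : conj 1 P = P := by
  ext g
  simp [mem_conj]

theorem conj_mono (x : G) {P P' : Subgroup G} (h : P ≤ P') : conj x P ≤ conj x P' :=
  Subgroup.map_mono h

theorem conj_unipotentRadical_le (x : G) (P : Subgroup G) :
    conj x (unipotentRadical P) ≤ unipotentRadical (conj x P) := by
  rw [conj, unipotentRadical, (Subgroup.gc_map_comap _).l_sSup]
  refine iSup₂_le ?_
  rintro U ⟨hU, hn, hu⟩
  refine le_sSup ⟨conj_mono x hU, ?_, ?_⟩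
  · intro p hp u hxu
    have h := hn _ (mem_conj.1 hp) _ ((mem_conj (x := x)).1 hxu)
    refine mem_conj.2 ?_
    convert h using 1
    group
  · intro u hxu
    obtain ⟨m, hm⟩ := hu _ ((mem_conj (x := x)).1 hxu)
    refine ⟨m, ?_⟩
    have e : (x⁻¹ * u * x).mat - 1 = (x⁻¹).mat * (u.mat - 1) * x.mat := by
      rw [G.mat_mul, G.mat_mul, mul_sub, sub_mul, mul_one, G.mat_inv_mul_mat]
    have e2 : ∀ m : ℕ, ((x⁻¹).mat * (u.mat - 1) * x.mat) ^ m =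
        (x⁻¹).mat * (u.mat - 1) ^ m * x.mat := by
      intro m
      induction m with
      | zero => simp
      | succ m ih => rw [pow_succ, ih, pow_succ]; simp [mul_assoc]
    rw [e, e2] at hm
    have h := congrArg (fun A => x.mat * A * (x⁻¹).mat) hm
    simpa [mul_assoc] using h

theorem unipotentRadical_conj (x : G) (P : Subgroup G) :
    unipotentRadical (conj x P) = conj x (unipotentRadical P) := by
  refine le_antisymm ?_ (conj_unipotentRadical_le x P)
  have h := conj_mono x (conj_unipotentRadical_le x⁻¹ (conj x P))
  rwa [conj_conj, conj_conj, mul_inv_cancel, inv_mul_cancel, conj_one, conj_one] at h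

/-! ### The hermitian matrix `g J g†` and its size -/

/-- The square of the Frobenius norm of a quaternionic matrix. -/
def frobSq (A : Mat) : ℝ := ∑ i, ∑ j, ‖A i j‖ ^ 2

theorem frobSq_nonneg (A : Mat) : 0 ≤ frobSq A :=
  Finset.sum_nonneg fun _ _ => Finset.sum_nonneg fun _ _ => by positivity

theorem norm_sq_le_frobSq (A : Mat) (i j : Fin 3) : ‖A i j‖ ^ 2 ≤ frobSq A :=
  (Finset.single_le_sum (f := fun j => ‖A i j‖ ^ 2) (fun _ _ => by positivity)
    (Finset.mem_univ j)).trans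
  (Finset.single_le_sum (f := fun i => ∑ j, ‖A i j‖ ^ 2)
    (fun _ _ => Finset.sum_nonneg fun _ _ => by positivity) (Finset.mem_univ i))

theorem frobSq_pos {A : Mat} (hA : A ≠ 0) : 0 < frobSq A := by
  obtain ⟨i, j, hij⟩ : ∃ i j, A i j ≠ 0 := by
    by_contra! h
    exact hA (Matrix.ext h)
  exact (pow_pos (norm_pos_iff.2 hij) 2).trans_le (norm_sq_le_frobSq A i j)

theorem frobSq_star (A : Mat) : frobSq (star A) = frobSq A := by
  rw [frobSq, frobSq, Finset.sum_comm]
  simp [Matrix.star_apply]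

theorem frobSq_mul_le (A B : Mat) : frobSq (A * B) ≤ frobSq A * frobSq B := by
  have h : ∀ i j, ‖(A * B) i j‖ ^ 2 ≤ (∑ k, ‖A i k‖ ^ 2) * ∑ k, ‖B k j‖ ^ 2 := by
    intro i j
    refine le_trans ?_ (Finset.sum_mul_sq_le_sq_mul_sq _ _ _)
    gcongr
    rw [Matrix.mul_apply]
    exact (norm_sum_le _ _).trans_eq (by simp)
  calc frobSq (A * B) ≤ ∑ i, ∑ j, (∑ k, ‖A i k‖ ^ 2) * ∑ k, ‖B k j‖ ^ 2 :=
        Finset.sum_le_sum fun i _ => Finset.sum_le_sum fun j _ => h i j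
    _ = frobSq A * frobSq B := by
        rw [frobSq, frobSq, Finset.sum_comm (f := fun i j => ‖B i j‖ ^ 2), Finset.sum_mul_sum]

/-- The hermitian matrix `g J g†`. The map `gH ↦ g J g†` identifies `G/H` with an orbit of `G` in
the space of hermitian matrices. -/
def herm (g : G) : Mat := g.mat * J * star g.mat

/-- The inverse of the hermitian matrix `g J g†`. -/
def hermInv (g : G) : Mat := star (g⁻¹).mat * J * (g⁻¹).mat

theorem herm_mul (x g : G) : herm (x * g) = x.mat * herm g * star x.mat := by
  simp [herm, mul_assoc]

theorem hermInv_mul (x g : G) :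
    hermInv (x * g) = star (x⁻¹).mat * hermInv g * (x⁻¹).mat := by
  simp [hermInv, mul_assoc]

theorem star_mat_mul_star_mat_inv (g : G) : star g.mat * star (g⁻¹).mat = 1 := by
  rw [← star_mul, G.mat_inv_mul_mat, star_one]

theorem star_mat_inv_mul_star_mat (g : G) : star (g⁻¹).mat * star g.mat = 1 := by
  rw [← star_mul, G.mat_mul_mat_inv, star_one]

theorem herm_mul_hermInv (g : G) : herm g * hermInv g = 1 := by
  simp only [herm, hermInv, mul_assoc]
  rw [← mul_assoc (star g.mat), star_mat_mul_star_mat_inv, one_mul, J_mul_J_mul,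
    G.mat_mul_mat_inv]

theorem herm_mul_of_mem_H (g : G) {h : G} (hh : h ∈ H) : herm (g * h) = herm g := by
  rw [herm, G.mat_mul, star_mul]
  calc g.mat * h.mat * J * (star h.mat * star g.mat)
      = g.mat * (h.mat * J * star h.mat) * star g.mat := by simp only [mul_assoc]
    _ = herm g := by rw [(mem_H_iff' h).1 hh, herm]

theorem hermInv_mul_of_mem_H (g : G) {h : G} (hh : h ∈ H) : hermInv (g * h) = hermInv g := by
  have h1 := herm_mul_hermInv (g * h)
  rw [herm_mul_of_mem_H g hh] at h1
  have h2 : hermInv g * herm g = 1 := by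
    simp only [herm, hermInv, mul_assoc]
    rw [G.mat_inv_mul_mat_mul, J_mul_J_mul, star_mat_inv_mul_star_mat]
  calc hermInv (g * h) = hermInv g * herm g * hermInv (g * h) := by rw [h2, one_mul]
    _ = hermInv g := by rw [mul_assoc, h1, mul_one]

theorem herm_ne_zero (g : G) : herm g ≠ 0 := fun h => by
  have := herm_mul_hermInv g
  rw [h, zero_mul] at this
  exact zero_ne_one this

theorem hermInv_ne_zero (g : G) : hermInv g ≠ 0 := fun h => by
  have := herm_mul_hermInv g
  rw [h, mul_zero] at this
  exact zero_ne_one this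

/-- The size `‖Y‖² ‖Y⁻¹‖²` of `Y = g J g†`, a function on `G/H` that is comparable with the weight
`∑ a^{wρ}` at the points `ka`. -/
def size (g : G) : ℝ := frobSq (herm g) * frobSq (hermInv g)

theorem size_pos (g : G) : 0 < size g :=
  mul_pos (frobSq_pos (herm_ne_zero g)) (frobSq_pos (hermInv_ne_zero g))

theorem size_mul_of_mem_H (g : G) {h : G} (hh : h ∈ H) : size (g * h) = size g := by
  rw [size, size, herm_mul_of_mem_H g hh, hermInv_mul_of_mem_H g hh]

theorem frobSq_mul_mul_le (A B C : Mat) :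
    frobSq (A * B * C) ≤ frobSq A * frobSq B * frobSq C :=
  (frobSq_mul_le _ _).trans (mul_le_mul_of_nonneg_right (frobSq_mul_le _ _) (frobSq_nonneg _))

theorem size_mul_le (x g : G) :
    size (x * g) ≤ (frobSq x.mat * frobSq (x⁻¹).mat) ^ 2 * size g := by
  rw [size, size, herm_mul, hermInv_mul]
  have h1 := frobSq_mul_mul_le x.mat (herm g) (star x.mat)
  have h2 := frobSq_mul_mul_le (star (x⁻¹).mat) (hermInv g) (x⁻¹).mat
  rw [frobSq_star] at h1 h2
  calc _ ≤ (frobSq x.mat * frobSq (herm g) * frobSq x.mat) *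
        (frobSq (x⁻¹).mat * frobSq (hermInv g) * frobSq (x⁻¹).mat) :=
        mul_le_mul h1 h2 (frobSq_nonneg _) ((frobSq_nonneg _).trans h1)
    _ = _ := by ring

/-- The power `‖Y‖^{-7/3} ‖Y⁻¹‖^{-7/3}` of the size, as a function on `G`. The exponent `-7/6` of
the size is less than `-1`, which makes the function a Schwartz function, and is large enough for
its integrals over the unipotent radicals of `Q₁` and `Q₄` to diverge. -/
def sizePow (g : G) : ℝ := size g ^ (-(7 / 6) : ℝ)

theorem sizePow_pos (g : G) : 0 < sizePow g := Real.rpow_pos_of_pos (size_pos g) _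

/-- The function on `G/H` defined by `sizePow`. -/
def witness : G ⧸ H → ℂ :=
  Quotient.lift (fun g => ((sizePow g : ℝ) : ℂ)) (by
    intro a b hab
    have h : a⁻¹ * b ∈ H := QuotientGroup.leftRel_apply.1 hab
    have := size_mul_of_mem_H a h
    rw [mul_inv_cancel_left] at this
    simp only [sizePow, this])

@[simp] theorem witness_mk (g : G) : witness (g : G ⧸ H) = ((sizePow g : ℝ) : ℂ) := rfl

theorem isPositive_witness : IsPositive witness := by
  intro x
  induction x using QuotientGroup.induction_on with
  | H g => simpa using sizePow_pos g

/-! ### Estimates on `KA` -/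

theorem frobSq_of_mem_K {k : G} (hk : k ∈ K) : frobSq k.mat = 3 := by
  have h1 : k.mat * star k.mat = 1 := by
    rw [← (mem_K_iff k).1 hk, star_star]
    rw [(mem_K_iff k).1 hk, G.mat_mul_mat_inv]
  have h2 : ∀ i, ∑ j, ‖k.mat i j‖ ^ 2 = 1 := by
    intro i
    have h3 := congrArg (fun A : Mat => (A i i).re) h1
    simp only [Matrix.mul_apply, Matrix.star_apply, Quaternion.self_mul_star, Matrix.one_apply_eq,
      Quaternion.normSq_eq_norm_mul_self, Fin.sum_univ_three, Quaternion.re_add,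
      Quaternion.re_coe, Quaternion.re_one, ← sq] at h3
    rwa [Fin.sum_univ_three]
  rw [frobSq, Finset.sum_congr rfl fun i _ => h2 i]
  simp

theorem size_le_of_mem_K {k : G} (hk : k ∈ K) (g : G) : size g ≤ 6561 * size (k * g) := by
  have h := size_mul_le k⁻¹ (k * g)
  rw [inv_mul_cancel_left, inv_inv, frobSq_of_mem_K hk, frobSq_of_mem_K (inv_mem hk)] at h
  norm_num at h
  linarith [size_pos (k * g)]

theorem exp_le_size {a : G} {t : Fin 3 → ℝ} (ha : IsExpDiag a t) (i j : Fin 3) :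
    Real.exp (4 * (t i - t j)) ≤ size a := by
  have hinv : (a⁻¹).mat = Matrix.diagonal fun i => ((Real.exp (-t i) : ℝ) : ℍ[ℝ]) := by
    apply G.mat_inv_eq
    rw [ha, Matrix.diagonal_mul_diagonal, ← Matrix.diagonal_one]
    congr 1
    funext i
    rw [← Quaternion.coe_mul, ← Real.exp_add]
    simp
  have hJ : ∀ i, ‖(![1, -1, -1] : Fin 3 → ℍ[ℝ]) i‖ = 1 := by
    intro i; fin_cases i <;> simp
  have h1 := norm_sq_le_frobSq (herm a) i i
  have h2 := norm_sq_le_frobSq (hermInv a) j j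
  have e1 : ‖herm a i i‖ = Real.exp (t i) * Real.exp (t i) := by
    rw [herm, ha, J_val, Matrix.star_eq_conjTranspose, Matrix.diagonal_conjTranspose,
      Matrix.diagonal_mul_diagonal, Matrix.diagonal_mul_diagonal, Matrix.diagonal_apply_eq]
    simp only [norm_mul, hJ, Pi.star_apply, Quaternion.star_coe, Quaternion.norm_coe,
      Real.norm_eq_abs, Real.abs_exp, mul_one]
  have e2 : ‖hermInv a j j‖ = Real.exp (-t j) * Real.exp (-t j) := by
    rw [hermInv, hinv, J_val, Matrix.star_eq_conjTranspose, Matrix.diagonal_conjTranspose,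
      Matrix.diagonal_mul_diagonal, Matrix.diagonal_mul_diagonal, Matrix.diagonal_apply_eq]
    simp only [norm_mul, hJ, Pi.star_apply, Quaternion.star_coe, Quaternion.norm_coe,
      Real.norm_eq_abs, Real.abs_exp, mul_one]
  rw [e1] at h1
  rw [e2] at h2
  calc Real.exp (4 * (t i - t j)) =
        (Real.exp (t i) * Real.exp (t i)) ^ 2 * (Real.exp (-t j) * Real.exp (-t j)) ^ 2 := by
        simp only [sq, ← Real.exp_add]; congr 1; ring
    _ ≤ size a := mul_le_mul h1 h2 (by positivity) (frobSq_nonneg _)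

theorem sum_eq_zero_of_isExpDiag {a : G} {t : Fin 3 → ℝ} (ha : IsExpDiag a t) :
    ∑ i, t i = 0 := by
  have h := G.studyDet_mat a
  rw [ha, studyDet_diagonal] at h
  have h2 : ∏ i, Real.exp (t i) ^ 2 = 1 := by exact_mod_cast h
  rw [Finset.prod_pow, ← Real.exp_sum] at h2
  have h3 : Real.exp (∑ i, t i) = 1 := (pow_eq_one_iff_of_nonneg (Real.exp_pos _).le two_ne_zero).1 h2
  exact Real.exp_eq_one_iff _ |>.1 h3

theorem weight_nonneg (t : Fin 3 → ℝ) : 0 ≤ weight t :=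
  Finset.sum_nonneg fun _ _ => (Real.exp_pos _).le

theorem weight_le {a : G} {t : Fin 3 → ℝ} (ha : IsExpDiag a t) : weight t ≤ 6 * size a := by
  have h : ∀ w : Equiv.Perm (Fin 3), Real.exp (rho (t ∘ w)) ≤ size a := by
    intro w
    have e : rho (t ∘ w) = 4 * (t (w 0) - t (w 2)) := by
      simp only [rho, Function.comp]; ring
    rw [e]
    exact exp_le_size ha _ _
  calc weight t ≤ ∑ _w : Equiv.Perm (Fin 3), size a := Finset.sum_le_sum fun w _ => h w
    _ = 6 * size a := by simp [Fintype.card_perm, Nat.factorial]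

/-- Any power of `1 + x` is dominated by an exponential. -/
theorem exists_one_add_rpow_le (r : ℝ) (hr : 0 ≤ r) :
    ∃ C : ℝ, 0 ≤ C ∧ ∀ x : ℝ, 0 ≤ x → (1 + x) ^ r ≤ C * Real.exp (x / 6) := by
  set c : ℝ := 1 + 6 * r with hc
  have hc1 : 1 ≤ c := by linarith
  have hc0 : 0 < c := by linarith
  refine ⟨c ^ r, by positivity, fun x hx => ?_⟩
  have h1 : 1 + x ≤ c * Real.exp (x / c) := by
    have h2 := Real.add_one_le_exp (x / c)
    calc 1 + x ≤ c + x := by linarith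
      _ = c * (x / c + 1) := by field_simp; ring
      _ ≤ c * Real.exp (x / c) := by gcongr
  calc (1 + x) ^ r ≤ (c * Real.exp (x / c)) ^ r := Real.rpow_le_rpow (by linarith) h1 hr
    _ = c ^ r * Real.exp (x / c * r) := by
        rw [Real.mul_rpow hc0.le (Real.exp_pos _).le, ← Real.exp_mul]
    _ ≤ c ^ r * Real.exp (x / 6) := by
        gcongr
        rw [div_mul_eq_mul_div, div_le_div_iff₀ hc0 (by norm_num)]
        nlinarith

theorem sqrt_le_log_size {a : G} {t : Fin 3 → ℝ} (ha : IsExpDiag a t) :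
    √(∑ i, t i ^ 2) ≤ Real.log (size a) := by
  set L := Real.log (size a)
  have h : ∀ i j, 4 * (t i - t j) ≤ L := fun i j =>
    (Real.le_log_iff_exp_le (size_pos a)).2 (exp_le_size ha i j)
  have h0 := sum_eq_zero_of_isExpDiag ha
  rw [Fin.sum_univ_three] at h0 ⊢
  have hL := h 0 0
  have h01 := h 0 1; have h02 := h 0 2; have h10 := h 1 0; have h12 := h 1 2
  have h20 := h 2 0; have h21 := h 2 1
  have b : ∀ x : ℝ, -(L / 6) ≤ x → x ≤ L / 6 → x ^ 2 ≤ L ^ 2 / 36 := fun x h1 h2 => by nlinarith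
  have b0 := b (t 0) (by linarith) (by linarith)
  have b1 := b (t 1) (by linarith) (by linarith)
  have b2 := b (t 2) (by linarith) (by linarith)
  exact (Real.sqrt_le_sqrt (by nlinarith)).trans_eq (Real.sqrt_sq (by linarith))

/-- The decay of `sizePow` along `KA`. -/
theorem exists_weight_mul_sizePow_le (r : ℝ) (hr : 0 ≤ r) :
    ∃ C : ℝ, 0 ≤ C ∧ ∀ k ∈ K, ∀ (a : G) (t : Fin 3 → ℝ), IsExpDiag a t →
      weight t * (1 + √(∑ i, t i ^ 2)) ^ r * sizePow (k * a) ≤ C := by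
  obtain ⟨C, hC, h⟩ := exists_one_add_rpow_le r hr
  refine ⟨6 * C * 6561 ^ (7 / 6 : ℝ), by positivity, fun k hk a t ha => ?_⟩
  have hs := size_pos a
  have h1 : (1 + √(∑ i, t i ^ 2)) ^ r ≤ C * size a ^ (1 / 6 : ℝ) := by
    refine (h _ (Real.sqrt_nonneg _)).trans ?_
    gcongr
    rw [Real.rpow_def_of_pos hs]
    gcongr
    linarith [sqrt_le_log_size ha]
  have h2 : sizePow (k * a) ≤ 6561 ^ (7 / 6 : ℝ) * size a ^ (-(7 / 6) : ℝ) := by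
    have h3 : size a / 6561 ≤ size (k * a) := by linarith [size_le_of_mem_K hk a]
    calc sizePow (k * a) ≤ (size a / 6561) ^ (-(7 / 6) : ℝ) :=
          Real.rpow_le_rpow_of_nonpos (by positivity) h3 (by norm_num)
      _ = _ := by
          rw [Real.div_rpow hs.le (by norm_num), Real.rpow_neg (by norm_num : (0 : ℝ) ≤ 6561)]
          field_simp
  calc _ ≤ 6 * size a * (C * size a ^ (1 / 6 : ℝ)) *
        (6561 ^ (7 / 6 : ℝ) * size a ^ (-(7 / 6) : ℝ)) := by
        have := weight_nonneg t
        have := weight_le ha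
        have := (sizePow_pos (k * a)).le
        gcongr
    _ = 6 * C * 6561 ^ (7 / 6 : ℝ) *
        (size a ^ (1 : ℝ) * size a ^ (1 / 6 : ℝ) * size a ^ (-(7 / 6) : ℝ)) := by
        rw [Real.rpow_one]; ring
    _ = _ := by
        rw [← Real.rpow_add hs, ← Real.rpow_add hs]
        norm_num

/-! ### Derivatives in the left regular representation -/

section Derivatives

open scoped Matrix.Norms.Operator

theorem oneParam_mat (X : lieAlg) (t : ℝ) : (oneParam X t).mat = NormedSpace.exp (t • (X : Mat)) :=
  (X.2 t).choose_spec

theorem oneParam_neg_zero (X : lieAlg) : oneParam X (-0) = 1 :=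
  G.mat_injective (by rw [oneParam_mat]; simp)

theorem oneParam_neg_inv_mat (X : lieAlg) (t : ℝ) :
    ((oneParam X (-t))⁻¹).mat = NormedSpace.exp (t • (X : Mat)) := by
  apply G.mat_inv_eq
  rw [oneParam_mat]
  have h : Commute (-t • (X : Mat)) (t • (X : Mat)) :=
    ((Commute.refl (X : Mat)).smul_left _).smul_right _
  let : NormedAlgebra ℚ Mat := NormedAlgebra.restrictScalars ℚ ℝ Mat
  refine (NormedSpace.exp_add_of_commute h).symm.trans ?_
  rw [neg_smul, neg_add_cancel, NormedSpace.exp_zero]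

theorem hasDerivAt_oneParam (X : lieAlg) :
    HasDerivAt (fun t : ℝ => (oneParam X (-t)).mat) (-(X : Mat)) 0 := by
  have h := hasDerivAt_exp_smul_const (𝕂 := ℝ) (-(X : Mat)) 0
  simp only [zero_smul, NormedSpace.exp_zero, one_mul] at h
  refine h.congr_of_eventuallyEq (Filter.Eventually.of_forall fun t => ?_)
  simp only [oneParam_mat, neg_smul, smul_neg]
  rfl

theorem hasDerivAt_oneParam_inv (X : lieAlg) :
    HasDerivAt (fun t : ℝ => ((oneParam X (-t))⁻¹).mat) (X : Mat) 0 := by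
  have h := hasDerivAt_exp_smul_const (𝕂 := ℝ) (X : Mat) 0
  simp only [zero_smul, NormedSpace.exp_zero, one_mul] at h
  refine h.congr_of_eventuallyEq (Filter.Eventually.of_forall fun t => ?_)
  simp only [oneParam_neg_inv_mat]
  rfl

/-- The conjugate transpose as a continuous real linear map. -/
def starL : Mat →L[ℝ] Mat :=
  LinearMap.toContinuousLinearMap
    { toFun := star, map_add' := star_add, map_smul' := fun c A => Matrix.ext fun i j => by simp [Matrix.star_apply] }

theorem hasDerivAt_star {f : ℝ → Mat} {f' : Mat} {x : ℝ} (h : HasDerivAt f f' x) :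
    HasDerivAt (fun t => star (f t)) (star f') x :=
  starL.hasFDerivAt.comp_hasDerivAt x h

/-- A real function `f` on `G` has the derivative `f'` along `X` in the left regular
representation. -/
def HasLieDeriv (X : lieAlg) (f f' : G → ℝ) : Prop :=
  ∀ g, HasDerivAt (fun t : ℝ => f (oneParam X (-t) * g)) (f' g) 0

/-- A matrix valued function on `G` whose derivatives along the Lie algebra are linear functions
of its value. -/
def MovesLinearly (M : G → Mat) : Prop :=
  ∀ X : lieAlg, ∃ L : Mat →ₗ[ℝ] Mat, ∀ g,
    HasDerivAt (fun t : ℝ => M (oneParam X (-t) * g)) (L (M g)) 0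

theorem movesLinearly_herm : MovesLinearly herm := by
  intro X
  refine ⟨-(LinearMap.mulLeft ℝ (X : Mat) + LinearMap.mulRight ℝ (star (X : Mat))), fun g => ?_⟩
  have h := ((hasDerivAt_oneParam X).mul_const (herm g)).mul (hasDerivAt_star (hasDerivAt_oneParam X))
  simp only [oneParam_neg_zero, G.mat_one, one_mul, star_one, mul_one, star_neg] at h
  refine (h.congr_deriv ?_).congr_of_eventuallyEq (Filter.Eventually.of_forall fun t => ?_)
  · simp [add_comm]
  · simp [herm_mul]

theorem movesLinearly_hermInv : MovesLinearly hermInv := by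
  intro X
  refine ⟨LinearMap.mulLeft ℝ (star (X : Mat)) + LinearMap.mulRight ℝ (X : Mat), fun g => ?_⟩
  have h := ((hasDerivAt_star (hasDerivAt_oneParam_inv X)).mul_const (hermInv g)).mul
    (hasDerivAt_oneParam_inv X)
  simp only [oneParam_neg_zero, inv_one, G.mat_one, one_mul, star_one, mul_one] at h
  refine (h.congr_deriv ?_).congr_of_eventuallyEq (Filter.Eventually.of_forall fun t => ?_)
  · simp
  · simp [hermInv_mul]

theorem HasLieDeriv.mul {X : lieAlg} {f f' k k' : G → ℝ} (hf : HasLieDeriv X f f')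
    (hk : HasLieDeriv X k k') : HasLieDeriv X (f * k) (f' * k + f * k') := fun g => by
  have h := (hf g).mul (hk g)
  simp only [oneParam_neg_zero, one_mul] at h
  exact h

theorem HasLieDeriv.add {X : lieAlg} {f f' k k' : G → ℝ} (hf : HasLieDeriv X f f')
    (hk : HasLieDeriv X k k') : HasLieDeriv X (f + k) (f' + k') := fun g => (hf g).add (hk g)

theorem exists_abs_bilin_le_norm {E : Type*} [NormedAddCommGroup E] [NormedSpace ℝ E]
    [FiniteDimensional ℝ E] (B : E →ₗ[ℝ] E →ₗ[ℝ] ℝ) : ∃ C, 0 ≤ C ∧ ∀ x, |B x x| ≤ C * ‖x‖ ^ 2 := by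
  refine ⟨‖B.toContinuousBilinearMap‖, ContinuousLinearMap.opNorm_nonneg _, fun x => ?_⟩
  have h := B.toContinuousBilinearMap.le_opNorm₂ x x
  rw [LinearMap.toContinuousBilinearMap_apply, Real.norm_eq_abs] at h
  exact h.trans_eq (by ring)

theorem hasDerivAt_bilin {E : Type*} [NormedAddCommGroup E] [NormedSpace ℝ E]
    [FiniteDimensional ℝ E] (B : E →ₗ[ℝ] E →ₗ[ℝ] ℝ) {m : ℝ → E} {m' : E} {x : ℝ}
    (h : HasDerivAt m m' x) :
    HasDerivAt (fun t => B (m t) (m t)) (B m' (m x) + B (m x) m') x :=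
  (B.toContinuousBilinearMap.hasFDerivAt.comp_hasDerivAt x h).clm_apply h

/-- The real bilinear form whose quadratic form is `frobSq`. -/
def frobBilin : Mat →ₗ[ℝ] Mat →ₗ[ℝ] ℝ :=
  LinearMap.mk₂ ℝ (fun A B => ∑ i, ∑ j, inner ℝ (A i j) (B i j))
    (fun A A' B => by simp [inner_add_left, Finset.sum_add_distrib])
    (fun c A B => by simp [inner_smul_left, Finset.mul_sum])
    (fun A B B' => by simp [inner_add_right, Finset.sum_add_distrib])
    (fun c A B => by simp [inner_smul_right, Finset.mul_sum])

theorem frobBilin_self (A : Mat) : frobBilin A A = frobSq A := by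
  simp [frobBilin, frobSq]

theorem norm_sq_le (A : Mat) : ‖A‖ ^ 2 ≤ 9 * frobSq A := by
  have h1 : ∀ i j, ‖A i j‖ ≤ √(frobSq A) := fun i j => Real.le_sqrt_of_sq_le (norm_sq_le_frobSq A i j)
  have h2 : ‖A‖ ≤ 3 * √(frobSq A) := by
    have h3 : ‖A‖₊ ≤ Real.toNNReal (3 * √(frobSq A)) := by
      rw [Matrix.linfty_opNNNorm_def]
      refine Finset.sup_le fun i _ => ?_
      rw [← NNReal.coe_le_coe, Real.coe_toNNReal _ (by positivity)]
      push_cast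
      calc ∑ j, ‖A i j‖ ≤ ∑ _j : Fin 3, √(frobSq A) := Finset.sum_le_sum fun j _ => h1 i j
        _ = 3 * √(frobSq A) := by simp
    have h4 := NNReal.coe_le_coe.2 h3
    rwa [Real.coe_toNNReal _ (by positivity)] at h4
  calc ‖A‖ ^ 2 ≤ (3 * √(frobSq A)) ^ 2 := by gcongr
    _ = 9 * frobSq A := by rw [mul_pow, Real.sq_sqrt (frobSq_nonneg A)]; norm_num

theorem exists_abs_bilin_le (B : Mat →ₗ[ℝ] Mat →ₗ[ℝ] ℝ) :
    ∃ C : ℝ, ∀ A, |B A A| ≤ C * frobSq A := by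
  obtain ⟨C, hC0, hC⟩ := exists_abs_bilin_le_norm B
  refine ⟨C * 9, fun A => (hC A).trans ?_⟩
  rw [mul_assoc]
  exact mul_le_mul_of_nonneg_left (norm_sq_le A) hC0

/-- The ratio of a quadratic form and the square of the Frobenius norm, evaluated along `M`. -/
def quadRatio (M : G → Mat) (B : Mat →ₗ[ℝ] Mat →ₗ[ℝ] ℝ) (g : G) : ℝ :=
  B (M g) (M g) / frobSq (M g)

theorem hasLieDeriv_bilin {M : G → Mat} {X : lieAlg} {L : Mat →ₗ[ℝ] Mat}
    (hL : ∀ g, HasDerivAt (fun t : ℝ => M (oneParam X (-t) * g)) (L (M g)) 0)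
    (B : Mat →ₗ[ℝ] Mat →ₗ[ℝ] ℝ) :
    HasLieDeriv X (fun g => B (M g) (M g))
      (fun g => (B ∘ₗ L + B.compl₂ L) (M g) (M g)) := by
  intro g
  have h := hasDerivAt_bilin B (hL g)
  simp only [oneParam_neg_zero, one_mul] at h
  exact h

/-- The derivative of `‖M‖²` is `‖M‖²` times a quadratic ratio. -/
theorem hasLieDeriv_frobSq {M : G → Mat} (h0 : ∀ g, M g ≠ 0) {X : lieAlg} {L : Mat →ₗ[ℝ] Mat}
    (hL : ∀ g, HasDerivAt (fun t : ℝ => M (oneParam X (-t) * g)) (L (M g)) 0) :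
    HasLieDeriv X (fun g => frobSq (M g)) (fun g => frobSq (M g) *
      quadRatio M (frobBilin ∘ₗ L + frobBilin.compl₂ L) g) := by
  intro g
  have h := hasLieDeriv_bilin hL frobBilin g
  simp only [frobBilin_self] at h
  refine h.congr_deriv ?_
  simp only [quadRatio]
  field_simp [(frobSq_pos (h0 g)).ne']

theorem hasLieDeriv_quadRatio {M : G → Mat} (h0 : ∀ g, M g ≠ 0) {X : lieAlg}
    {L : Mat →ₗ[ℝ] Mat}
    (hL : ∀ g, HasDerivAt (fun t : ℝ => M (oneParam X (-t) * g)) (L (M g)) 0)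
    (B : Mat →ₗ[ℝ] Mat →ₗ[ℝ] ℝ) :
    HasLieDeriv X (quadRatio M B) (quadRatio M (B ∘ₗ L + B.compl₂ L) -
      quadRatio M B * quadRatio M (frobBilin ∘ₗ L + frobBilin.compl₂ L)) := by
  intro g
  have hne := (frobSq_pos (h0 g)).ne'
  have h := (hasLieDeriv_bilin hL B g).div (hasLieDeriv_frobSq h0 hL g)
    (by simpa only [oneParam_neg_zero, one_mul] using hne)
  simp only [oneParam_neg_zero, one_mul] at h
  refine h.congr_deriv ?_
  simp only [Pi.sub_apply, Pi.mul_apply, quadRatio]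
  field_simp

/-- The algebra of functions on `G` generated by the quadratic ratios of `Y = g J g†` and of
`Y⁻¹`. Its elements are bounded, and it is stable under the left regular representation of the
Lie algebra. -/
def ratioAlg : Subalgebra ℝ (G → ℝ) :=
  Algebra.adjoin ℝ (Set.range (quadRatio herm) ∪ Set.range (quadRatio hermInv))

theorem quadRatio_herm_mem (B : Mat →ₗ[ℝ] Mat →ₗ[ℝ] ℝ) : quadRatio herm B ∈ ratioAlg :=
  Algebra.subset_adjoin (Or.inl ⟨B, rfl⟩)

theorem quadRatio_hermInv_mem (B : Mat →ₗ[ℝ] Mat →ₗ[ℝ] ℝ) : quadRatio hermInv B ∈ ratioAlg :=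
  Algebra.subset_adjoin (Or.inr ⟨B, rfl⟩)

theorem exists_abs_quadRatio_le {M : G → Mat} (h0 : ∀ g, M g ≠ 0)
    (B : Mat →ₗ[ℝ] Mat →ₗ[ℝ] ℝ) : ∃ C, ∀ g, |quadRatio M B g| ≤ C := by
  obtain ⟨C, hC⟩ := exists_abs_bilin_le B
  refine ⟨C, fun g => ?_⟩
  have hp := frobSq_pos (h0 g)
  rw [quadRatio, abs_div, abs_of_pos hp, div_le_iff₀ hp]
  exact hC _

theorem exists_abs_le_of_mem_ratioAlg {b : G → ℝ} (hb : b ∈ ratioAlg) : ∃ C, ∀ g, |b g| ≤ C := by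
  induction hb using Algebra.adjoin_induction with
  | mem x hx =>
    rcases hx with ⟨B, rfl⟩ | ⟨B, rfl⟩
    · exact exists_abs_quadRatio_le herm_ne_zero B
    · exact exists_abs_quadRatio_le hermInv_ne_zero B
  | algebraMap r => exact ⟨|r|, fun g => le_rfl⟩
  | add x y _ _ hx hy =>
    obtain ⟨C, hC⟩ := hx
    obtain ⟨D, hD⟩ := hy
    exact ⟨C + D, fun g => (abs_add_le _ _).trans (add_le_add (hC g) (hD g))⟩
  | mul x y _ _ hx hy =>
    obtain ⟨C, hC⟩ := hx
    obtain ⟨D, hD⟩ := hy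
    refine ⟨C * D, fun g => ?_⟩
    rw [Pi.mul_apply, abs_mul]
    exact mul_le_mul (hC g) (hD g) (abs_nonneg _) ((abs_nonneg _).trans (hC g))

theorem exists_hasLieDeriv_of_mem_ratioAlg (X : lieAlg) {b : G → ℝ} (hb : b ∈ ratioAlg) :
    ∃ b' ∈ ratioAlg, HasLieDeriv X b b' := by
  induction hb using Algebra.adjoin_induction with
  | mem x hx =>
    rcases hx with ⟨B, rfl⟩ | ⟨B, rfl⟩
    · obtain ⟨L, hL⟩ := movesLinearly_herm X
      exact ⟨_, sub_mem (quadRatio_herm_mem _) (mul_mem (quadRatio_herm_mem _)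
        (quadRatio_herm_mem _)), hasLieDeriv_quadRatio herm_ne_zero hL B⟩
    · obtain ⟨L, hL⟩ := movesLinearly_hermInv X
      exact ⟨_, sub_mem (quadRatio_hermInv_mem _) (mul_mem (quadRatio_hermInv_mem _)
        (quadRatio_hermInv_mem _)), hasLieDeriv_quadRatio hermInv_ne_zero hL B⟩
  | algebraMap r => exact ⟨0, zero_mem _, fun g => hasDerivAt_const _ _⟩
  | add x y _ _ hx hy =>
    obtain ⟨x', hx', h1⟩ := hx
    obtain ⟨y', hy', h2⟩ := hy
    exact ⟨_, add_mem hx' hy', h1.add h2⟩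
  | mul x y hxm hym hx hy =>
    obtain ⟨x', hx', h1⟩ := hx
    obtain ⟨y', hy', h2⟩ := hy
    exact ⟨_, add_mem (mul_mem hx' hym) (mul_mem hxm hy'), h1.mul h2⟩

theorem exists_hasLieDeriv_sizePow (X : lieAlg) :
    ∃ b ∈ ratioAlg, HasLieDeriv X sizePow (sizePow * b) := by
  obtain ⟨L, hL⟩ := movesLinearly_herm X
  obtain ⟨L', hL'⟩ := movesLinearly_hermInv X
  refine ⟨(-(7 / 6) : ℝ) • (quadRatio herm (frobBilin ∘ₗ L + frobBilin.compl₂ L) +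
    quadRatio hermInv (frobBilin ∘ₗ L' + frobBilin.compl₂ L')),
    ratioAlg.smul_mem (add_mem (quadRatio_herm_mem _) (quadRatio_hermInv_mem _)) _, fun g => ?_⟩
  have h1 := (hasLieDeriv_frobSq herm_ne_zero hL).mul (hasLieDeriv_frobSq hermInv_ne_zero hL') g
  have hs := size_pos g
  have h2 := h1.rpow_const (p := (-(7 / 6) : ℝ)) (Or.inl (by
    simp only [oneParam_neg_zero, one_mul]
    exact hs.ne'))
  refine h2.congr_deriv ?_
  simp only [oneParam_neg_zero, one_mul, Pi.add_apply, Pi.mul_apply, Pi.smul_apply, smul_eq_mul]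
  change _ * _ * size g ^ _ = _
  rw [Real.rpow_sub_one hs.ne', sizePow]
  field_simp
  rw [size]
  ring

/-- All derivatives of `sizePow` are products of `sizePow` and a function in `ratioAlg`. -/
theorem exists_wordDeriv_eq (u : List lieAlg) :
    ∃ b ∈ ratioAlg, wordDeriv u (fun g => ((sizePow g : ℝ) : ℂ)) =
      fun g => ((sizePow g * b g : ℝ) : ℂ) := by
  induction u with
  | nil => exact ⟨1, one_mem _, by simp [wordDeriv]⟩
  | cons X u ih =>
    obtain ⟨b, hb, h⟩ := ih
    obtain ⟨c, hc, h1⟩ := exists_hasLieDeriv_sizePow X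
    obtain ⟨b', hb', h2⟩ := exists_hasLieDeriv_of_mem_ratioAlg X hb
    refine ⟨c * b + b', add_mem (mul_mem hc hb) hb', ?_⟩
    have e : wordDeriv (X :: u) (fun g => ((sizePow g : ℝ) : ℂ)) =
        lieDeriv X (wordDeriv u (fun g => ((sizePow g : ℝ) : ℂ))) := rfl
    rw [e, h]
    funext g
    have h3 := (h1.mul h2 g).ofReal_comp
    refine h3.deriv.trans ?_
    simp only [Pi.add_apply, Pi.mul_apply]
    congr 1
    ring

end Derivatives

/-! ### The Schwartz property -/

section Smoothness

open scoped Matrix.Norms.Operator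

theorem contDiff_frobSq : ContDiff ℝ ∞ frobSq := by
  refine ContDiff.sum fun i _ => ContDiff.sum fun j _ => ContDiff.norm_sq ℝ ?_
  exact (LinearMap.toContinuousLinearMap (Matrix.entryLinearMap ℝ ℍ[ℝ] i j)).contDiff

/-- The extension of `size` to invertible matrices. -/
def sizeExt (A : Mat) : ℝ :=
  frobSq (A * J * star A) * frobSq (star (Ring.inverse A) * J * Ring.inverse A)

theorem sizeExt_mat (g : G) : sizeExt g.mat = size g := by
  have h : Ring.inverse g.mat = (g⁻¹).mat := Ring.inverse_unit (g : Matˣ)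
  rw [sizeExt, h, size, herm, hermInv]

theorem isUnit_J : IsUnit (J : Mat) := J.isUnit

theorem sizeExt_ne_zero {A : Mat} (hA : IsUnit A) : sizeExt A ≠ 0 := by
  have h1 : IsUnit (A * J * star A) := (hA.mul isUnit_J).mul hA.star
  have hB : IsUnit (Ring.inverse A) := hA.ringInverse
  have h2 : IsUnit (star (Ring.inverse A) * J * Ring.inverse A) := (hB.star.mul isUnit_J).mul hB
  exact mul_ne_zero (frobSq_pos h1.ne_zero).ne' (frobSq_pos h2.ne_zero).ne'

theorem contDiffAt_sizeExt {A : Mat} (hA : IsUnit A) : ContDiffAt ℝ ∞ sizeExt A := by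
  obtain ⟨u, rfl⟩ := hA
  have h1 : ContDiffAt ℝ ∞ (Ring.inverse : Mat → Mat) (u : Mat) := contDiffAt_ringInverse ℝ u
  have h2 : ContDiffAt ℝ ∞ (fun A : Mat => star A) (u : Mat) := starL.contDiff.contDiffAt
  have h3 : ContDiffAt ℝ ∞ (fun A : Mat => star (Ring.inverse A)) (u : Mat) :=
    starL.contDiff.contDiffAt.comp _ h1
  refine (contDiff_frobSq.contDiffAt.comp _ ?_).mul (contDiff_frobSq.contDiffAt.comp _ ?_)
  · exact (contDiffAt_id.mul contDiffAt_const).mul h2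
  · exact (h3.mul contDiffAt_const).mul h1

theorem isSmooth_sizePow : IsSmooth (fun g => ((sizePow g : ℝ) : ℂ)) := by
  let e : (Fin 3 → Fin 3 → ℍ[ℝ]) →L[ℝ] Mat :=
    LinearMap.toContinuousLinearMap (Matrix.ofLinearEquiv ℝ).toLinearMap
  intro g
  refine ⟨e ⁻¹' {A | IsUnit A}, fun A => ((sizeExt (e A) ^ (-(7 / 6) : ℝ) : ℝ) : ℂ), ?_, ?_, ?_, ?_⟩
  · exact Units.isOpen.preimage e.continuous
  · exact (g : Matˣ).isUnit
  · intro A hA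
    refine ContDiffAt.contDiffWithinAt ?_
    have h1 : ContDiffAt ℝ ∞ (fun A => sizeExt (e A)) A :=
      (contDiffAt_sizeExt hA).comp A e.contDiff.contDiffAt
    exact Complex.ofRealCLM.contDiff.contDiffAt.comp A
      (h1.rpow_const_of_ne (sizeExt_ne_zero hA))
  · intro x _
    have h : sizeExt (e fun i j => x.mat i j) = size x := sizeExt_mat x
    simp only [h, sizePow]

end Smoothness

theorem isSchwartz_witness : IsSchwartz witness := by
  refine ⟨isSmooth_sizePow, fun u r hr => ?_⟩
  obtain ⟨b, hb, h⟩ := exists_wordDeriv_eq u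
  obtain ⟨C, hC⟩ := exists_abs_le_of_mem_ratioAlg hb
  obtain ⟨D, hD0, hD⟩ := exists_weight_mul_sizePow_le r hr
  refine ⟨D * C, fun k hk a t ha => ?_⟩
  simp only [witness_mk, h]
  rw [Complex.norm_real, norm_mul, Real.norm_eq_abs, Real.norm_eq_abs,
    abs_of_pos (sizePow_pos _), ← mul_assoc]
  exact mul_le_mul (hD k hk a t ha) (hC _) (abs_nonneg _) hD0

/-! ### Continuity -/

theorem continuous_mat : Continuous G.mat :=
  Units.continuous_val.comp continuous_subtype_val

theorem continuous_mkG {T : Type*} [TopologicalSpace T] {f : T → G}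
    (h : Continuous fun t => (f t).mat) (h' : Continuous fun t => ((f t)⁻¹).mat) :
    Continuous f :=
  Continuous.subtype_mk (f := fun t => ((f t : G) : Matˣ)) (Units.continuous_iff.2 ⟨h, h'⟩) _

theorem IsSmooth.continuous {f : G → ℂ} (hf : IsSmooth f) : Continuous f := by
  rw [continuous_iff_continuousAt]
  intro g
  obtain ⟨U, F, hU, hg, hF, hfF⟩ := hf g
  have hc : Continuous fun x : G => fun i j => x.mat i j := continuous_mat
  have h1 : ContinuousAt (fun x : G => F fun i j => x.mat i j) g :=
    ContinuousAt.comp (f := fun x : G => fun i j => x.mat i j)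
      (hF.continuousOn.continuousAt (hU.mem_nhds hg)) hc.continuousAt
  refine h1.congr ?_
  filter_upwards [hc.continuousAt.preimage_mem_nhds (hU.mem_nhds hg)] with x hx
  exact (hfF x hx).symm

/-! ### A divergent integral on `ℍ²` -/

open MeasureTheory

instance : MeasurableSpace ℍ[ℝ] := borel _

instance : BorelSpace ℍ[ℝ] := ⟨rfl⟩

/-- Lebesgue measure on the quaternions, up to normalization. -/
abbrev quatVol : Measure ℍ[ℝ] := Measure.addHaar

theorem lintegral_one_add_norm_rpow_eq_top :
    ∫⁻ x : ℍ[ℝ], ENNReal.ofReal ((1 + ‖x‖) ^ (-4 : ℝ)) ∂quatVol = ⊤ := by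
  by_contra hfin
  have hcont : Continuous fun y : ℝ => (1 + |y|) ^ (-4 : ℝ) :=
    (continuous_const.add continuous_abs).rpow_const fun y =>
      Or.inl (by positivity : 1 + |y| ≠ 0)
  have h1 : Integrable (fun x : ℍ[ℝ] => (1 + |‖x‖|) ^ (-4 : ℝ)) quatVol := by
    refine ⟨(hcont.comp continuous_norm).aestronglyMeasurable, ?_⟩
    rw [hasFiniteIntegral_iff_ofReal (Filter.Eventually.of_forall fun x => by positivity)]
    simpa only [abs_norm] using lt_top_iff_ne_top.2 hfin
  rw [integrable_fun_norm_addHaar quatVol (f := fun y => (1 + |y|) ^ (-4 : ℝ)),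
    Quaternion.finrank_eq_four] at h1
  have h2 : IntegrableOn (fun y : ℝ => y⁻¹) (Set.Ioi 1) := by
    refine ((h1.mono_set (Set.Ioi_subset_Ioi zero_le_one)).const_mul 16).mono'
      measurable_inv.aestronglyMeasurable ?_
    refine (ae_restrict_iff' measurableSet_Ioi).2 (Filter.Eventually.of_forall fun y hy => ?_)
    have hy1 : (1 : ℝ) < y := hy
    have hy0 : 0 < y := by linarith
    rw [Real.norm_of_nonneg (by positivity), abs_of_pos hy0, smul_eq_mul,
      Real.rpow_neg (by positivity), show (4 : ℝ) = ((4 : ℕ) : ℝ) by norm_num, Real.rpow_natCast]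
    have h3 : (1 + y) ^ 4 ≤ (2 * y) ^ 4 := by gcongr; linarith
    rw [inv_eq_one_div, ← div_eq_mul_inv, ← mul_div_assoc, div_le_div_iff₀ hy0 (by positivity)]
    norm_num
    nlinarith
  exact not_integrableOn_Ioi_inv h2

/-- The volume of a spherical shell of thickness one in `ℍ = ℝ⁴`. -/
theorem le_quatVol_shell {R : ℝ} (hR : 0 ≤ R) :
    ENNReal.ofReal ((1 + R) ^ 3) * quatVol (Metric.ball 0 1) ≤
      quatVol {y : ℍ[ℝ] | R ≤ ‖y‖ ∧ ‖y‖ < R + 1} := by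
  have hv : quatVol (Metric.ball (0 : ℍ[ℝ]) 1) ≠ ⊤ := measure_ball_lt_top.ne
  have e : {y : ℍ[ℝ] | R ≤ ‖y‖ ∧ ‖y‖ < R + 1} = Metric.ball 0 (R + 1) \ Metric.ball 0 R := by
    ext y
    simp [and_comm]
  rw [e, measure_sdiff (Metric.ball_subset_ball (by linarith)) measurableSet_ball.nullMeasurableSet
      measure_ball_lt_top.ne, Measure.addHaar_ball _ _ (by linarith : 0 ≤ R + 1),
    Measure.addHaar_ball _ _ hR, Quaternion.finrank_eq_four, ← ENNReal.sub_mul (fun _ _ => hv),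
    ← ENNReal.ofReal_sub _ (by positivity)]
  gcongr
  nlinarith [pow_nonneg hR 3, pow_nonneg hR 2]

theorem lintegral_eq_top_of_le {F : ℍ[ℝ] × ℍ[ℝ] → ENNReal} (hF : Measurable F) {c : ℝ}
    (hc : 0 < c) (h : ∀ x y : ℍ[ℝ], ‖x‖ ≤ ‖y‖ → ‖y‖ < ‖x‖ + 1 →
      ENNReal.ofReal (c * (1 + ‖x‖) ^ (-7 : ℝ)) ≤ F (x, y)) :
    ∫⁻ p, F p ∂(quatVol.prod quatVol) = ⊤ := by
  set v := quatVol (Metric.ball (0 : ℍ[ℝ]) 1)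
  have hv : v ≠ 0 := (Metric.measure_ball_pos _ _ one_pos).ne'
  rw [lintegral_prod _ hF.aemeasurable, eq_top_iff]
  calc ⊤ = ENNReal.ofReal c * v * ∫⁻ x : ℍ[ℝ], ENNReal.ofReal ((1 + ‖x‖) ^ (-4 : ℝ)) ∂quatVol := by
        rw [lintegral_one_add_norm_rpow_eq_top, ENNReal.mul_top]
        exact mul_ne_zero (ENNReal.ofReal_pos.2 hc).ne' hv
    _ = ∫⁻ x : ℍ[ℝ], ENNReal.ofReal c * v * ENNReal.ofReal ((1 + ‖x‖) ^ (-4 : ℝ)) ∂quatVol := by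
        rw [lintegral_const_mul]
        have hcont : Continuous fun x : ℍ[ℝ] => (1 + ‖x‖) ^ (-4 : ℝ) :=
          (continuous_const.add continuous_norm).rpow_const fun y =>
            Or.inl (by positivity : 1 + ‖y‖ ≠ 0)
        exact hcont.measurable.ennreal_ofReal
    _ ≤ ∫⁻ x, ∫⁻ y, F (x, y) ∂quatVol ∂quatVol := lintegral_mono fun x => ?_
  have hx : 0 < 1 + ‖x‖ := by positivity
  have hS : MeasurableSet {y : ℍ[ℝ] | ‖x‖ ≤ ‖y‖ ∧ ‖y‖ < ‖x‖ + 1} :=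
    (measurableSet_le measurable_const measurable_norm).inter
      (measurableSet_lt measurable_norm measurable_const)
  calc ENNReal.ofReal c * v * ENNReal.ofReal ((1 + ‖x‖) ^ (-4 : ℝ))
      = ENNReal.ofReal (c * (1 + ‖x‖) ^ (-7 : ℝ)) * (ENNReal.ofReal ((1 + ‖x‖) ^ 3) * v) := by
        have e : (1 + ‖x‖) ^ (-4 : ℝ) = (1 + ‖x‖) ^ (-7 : ℝ) * (1 + ‖x‖) ^ 3 := by
          rw [← Real.rpow_natCast (1 + ‖x‖) 3, ← Real.rpow_add hx]
          norm_num
        rw [e, ENNReal.ofReal_mul hc.le, ENNReal.ofReal_mul (by positivity)]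
        ring
    _ ≤ ENNReal.ofReal (c * (1 + ‖x‖) ^ (-7 : ℝ)) *
        quatVol {y : ℍ[ℝ] | ‖x‖ ≤ ‖y‖ ∧ ‖y‖ < ‖x‖ + 1} := by
        gcongr
        exact le_quatVol_shell (norm_nonneg x)
    _ = ∫⁻ _y in {y : ℍ[ℝ] | ‖x‖ ≤ ‖y‖ ∧ ‖y‖ < ‖x‖ + 1},
        ENNReal.ofReal (c * (1 + ‖x‖) ^ (-7 : ℝ)) ∂quatVol := by rw [setLIntegral_const]
    _ ≤ ∫⁻ y in {y : ℍ[ℝ] | ‖x‖ ≤ ‖y‖ ∧ ‖y‖ < ‖x‖ + 1}, F (x, y) ∂quatVol :=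
        setLIntegral_mono' hS fun y hy => h x y hy.1 hy.2
    _ ≤ ∫⁻ y, F (x, y) ∂quatVol := setLIntegral_le_lintegral _ _

/-! ### Haar measures in coordinates -/

instance (N : Subgroup G) : MeasurableSpace N := borel N

instance (N : Subgroup G) : BorelSpace N := ⟨rfl⟩

instance : SecondCountableTopology Mat :=
  inferInstanceAs (SecondCountableTopology (Fin 3 → Fin 3 → ℍ[ℝ]))

instance : SecondCountableTopology Matˣ :=
  haveI : SecondCountableTopology Matᵐᵒᵖ := MulOpposite.opHomeomorph.symm.secondCountableTopology
  Units.isEmbedding_embedProduct.secondCountableTopology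

instance : SecondCountableTopology G :=
  (Topology.IsEmbedding.subtypeVal (p := fun g : Matˣ => g ∈ specialLinear)).secondCountableTopology

instance (N : Subgroup G) : SecondCountableTopology N :=
  (Topology.IsEmbedding.subtypeVal (p := fun g : G => g ∈ N)).secondCountableTopology

/-- An integral over a group diverges for every Haar measure as soon as it diverges for a left
invariant measure that is given in coordinates. -/
theorem lintegral_eq_top_of_homeomorph {N X : Type*} [Group N] [TopologicalSpace N]
    [IsTopologicalGroup N] [MeasurableSpace N] [BorelSpace N] [LocallyCompactSpace N]
    [SecondCountableTopology N] [TopologicalSpace X] [MeasurableSpace X] [BorelSpace X]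
    (e : X ≃ₜ N) (vol : Measure X) [IsFiniteMeasureOnCompacts vol]
    (hinv : ∀ (n : N) (f : N → ENNReal), Measurable f →
      ∫⁻ x, f (n * e x) ∂vol = ∫⁻ x, f (e x) ∂vol)
    (μ : Measure N) [μ.IsHaarMeasure] {F : N → ENNReal} (hF : Measurable F)
    (h : ∫⁻ x, F (e x) ∂vol = ⊤) : ∫⁻ n, F n ∂μ = ⊤ := by
  have he : Measurable e := e.continuous.measurable
  have h1 : IsFiniteMeasureOnCompacts (vol.map e) := Measure.IsFiniteMeasureOnCompacts.map vol e
  have h2 : (vol.map e).IsMulLeftInvariant := by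
    refine ⟨fun n => Measure.ext_of_lintegral _ fun f hf => ?_⟩
    have hfn : Measurable fun m => f (n * m) := hf.comp (measurable_const_mul n)
    rw [lintegral_map hf (measurable_const_mul n), lintegral_map hfn he, lintegral_map hf he]
    exact hinv n f hf
  have h3 := Measure.isMulLeftInvariant_eq_smul (vol.map e) μ
  have h4 : ∫⁻ n, F n ∂(vol.map e) = ⊤ := by rw [lintegral_map hF he, h]
  rw [h3] at h4
  by_contra hne
  change ∫⁻ n, F n ∂(((Measure.haarScalarFactor (vol.map e) μ : ENNReal)) • μ) = ⊤ at h4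
  rw [lintegral_smul_measure] at h4
  exact ENNReal.mul_ne_top ENNReal.coe_ne_top hne h4

theorem elem_add {i j : Fin 3} (h : i ≠ j) (p q : ℍ[ℝ]) :
    elem i j h (p + q) = elem i j h p * elem i j h q := by
  apply G.mat_injective
  rw [G.mat_mul, elem_mat, elem_mat, elem_mat, Matrix.single_add]
  simp only [add_mul, one_mul, mul_one, mul_add, single_mul_single_self h, add_zero]
  abel

theorem elem_zero {i j : Fin 3} (h : i ≠ j) : elem i j h 0 = 1 := by
  apply G.mat_injective
  simp [elem_mat]

theorem elem_neg {i j : Fin 3} (h : i ≠ j) (q : ℍ[ℝ]) : elem i j h (-q) = (elem i j h q)⁻¹ := by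
  rw [eq_inv_iff_mul_eq_one, ← elem_add, neg_add_cancel, elem_zero]

theorem continuous_elem {i j : Fin 3} (h : i ≠ j) : Continuous (elem i j h) := by
  have h1 : Continuous fun q : ℍ[ℝ] => (Matrix.single i j q : Mat) :=
    continuous_matrix fun a b => by
      simp only [Matrix.single_apply]
      split_ifs
      · exact continuous_id
      · exact continuous_const
  exact continuous_mkG (continuous_const.add h1) (continuous_const.sub h1)

theorem continuous_mat_apply (i j : Fin 3) : Continuous fun g : G => g.mat i j :=
  continuous_mat.matrix_elem i j

theorem elem_mul_mat_apply {i j : Fin 3} (h : i ≠ j) (q : ℍ[ℝ]) (g : G) (a b : Fin 3) :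
    (elem i j h q * g).mat a b = g.mat a b + if a = i then q * g.mat j b else 0 := by
  rw [G.mat_mul, elem_mat, add_mul, one_mul, Matrix.add_apply]
  congr 1
  split_ifs with ha
  · rw [ha, Matrix.single_mul_apply_same]
  · rw [Matrix.single_mul_apply_of_ne _ _ _ _ _ ha]

/-! ### Abelian unipotent radicals -/

/-- Two distinct commuting positions `(i,j)` and `(k,l)` off the diagonal, which are the only
positions of positive weight for `v`. -/
structure IsPair (v : Fin 3 → ℝ) (i j k l : Fin 3) : Prop where
  ij : i ≠ j
  kl : k ≠ l
  jk : j ≠ k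
  li : l ≠ i
  ne : (i, j) ≠ (k, l)
  iff : ∀ a b, v b < v a ↔ (a, b) = (i, j) ∨ (a, b) = (k, l)

/-- The element `1 + x Eᵢⱼ + y Eₖₗ`. -/
def IsPair.elem {v : Fin 3 → ℝ} {i j k l : Fin 3} (h : IsPair v i j k l) (p : ℍ[ℝ] × ℍ[ℝ]) : G :=
  SLThreeH.elem i j h.ij p.1 * SLThreeH.elem k l h.kl p.2

theorem IsPair.elem_mat {v : Fin 3 → ℝ} {i j k l : Fin 3} (h : IsPair v i j k l)
    (p : ℍ[ℝ] × ℍ[ℝ]) :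
    (h.elem p).mat = 1 + Matrix.single i j p.1 + Matrix.single k l p.2 := by
  rw [IsPair.elem, G.mat_mul, SLThreeH.elem_mat, SLThreeH.elem_mat]
  simp only [add_mul, mul_add, one_mul, mul_one, Matrix.single_mul_single_of_ne _ _ _ _ h.jk]
  abel

theorem IsPair.elem_mat_apply {v : Fin 3 → ℝ} {i j k l : Fin 3} (h : IsPair v i j k l)
    (p : ℍ[ℝ] × ℍ[ℝ]) (a b : Fin 3) : (h.elem p).mat a b = (1 : Mat) a b +
      (if i = a ∧ j = b then p.1 else 0) + if k = a ∧ l = b then p.2 else 0 := by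
  rw [h.elem_mat, Matrix.add_apply, Matrix.add_apply, Matrix.single_apply, Matrix.single_apply]

theorem IsPair.elem_add {v : Fin 3 → ℝ} {i j k l : Fin 3} (h : IsPair v i j k l)
    (p q : ℍ[ℝ] × ℍ[ℝ]) : h.elem (p + q) = h.elem p * h.elem q := by
  apply G.mat_injective
  rw [G.mat_mul, h.elem_mat, h.elem_mat, h.elem_mat, Prod.fst_add, Prod.snd_add, Matrix.single_add,
    Matrix.single_add]
  simp only [add_mul, mul_add, one_mul, mul_one, single_mul_single_self h.ij,
    single_mul_single_self h.kl, Matrix.single_mul_single_of_ne _ _ _ _ h.jk,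
    Matrix.single_mul_single_of_ne _ _ _ _ h.li, add_zero]
  abel

/-- The unipotent radical attached to a pair of positions is `ℍ²`. -/
def IsPair.homeo {v : Fin 3 → ℝ} {i j k l : Fin 3} (h : IsPair v i j k l) :
    ℍ[ℝ] × ℍ[ℝ] ≃ₜ stdRadical v where
  toFun p := ⟨h.elem p, mem_stdRadical.2 fun a b hab => by
    have h1 := mt (h.iff a b).2 (not_lt.2 hab)
    rw [h.elem_mat_apply, if_neg, if_neg, add_zero, add_zero]
    · rintro ⟨rfl, rfl⟩; exact h1 (Or.inr rfl)
    · rintro ⟨rfl, rfl⟩; exact h1 (Or.inl rfl)⟩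
  invFun n := ((n : G).mat i j, (n : G).mat k l)
  left_inv p := by
    have h1 : ¬ (k = i ∧ l = j) := fun h2 => h.ne (by rw [h2.1, h2.2])
    have h2 : ¬ (i = k ∧ j = l) := fun h2 => h.ne (by rw [h2.1, h2.2])
    refine Prod.ext ?_ ?_
    · simp [h.elem_mat_apply, h1, Matrix.one_apply_ne h.ij]
    · simp [h.elem_mat_apply, h2, Matrix.one_apply_ne h.kl]
  right_inv n := by
    refine Subtype.ext (G.mat_injective (Matrix.ext fun a b => ?_))
    have hne : ¬ (k = i ∧ l = j) := fun h2 => h.ne (by rw [h2.1, h2.2])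
    rw [h.elem_mat_apply]
    by_cases h1 : i = a ∧ j = b
    · obtain ⟨rfl, rfl⟩ := h1
      simp [hne, Matrix.one_apply_ne h.ij]
    by_cases h2 : k = a ∧ l = b
    · obtain ⟨rfl, rfl⟩ := h2
      simp [h1, Matrix.one_apply_ne h.kl]
    rw [if_neg h1, if_neg h2, add_zero, add_zero]
    refine (mem_stdRadical.1 n.2 a b (le_of_not_gt fun h3 => ?_)).symm
    rcases (h.iff a b).1 h3 with h4 | h4
    · exact h1 (by simpa [eq_comm] using h4)
    · exact h2 (by simpa [eq_comm] using h4)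
  continuous_toFun := Continuous.subtype_mk (((continuous_elem h.ij).comp continuous_fst).mul
    ((continuous_elem h.kl).comp continuous_snd)) _
  continuous_invFun := ((continuous_mat_apply i j).comp continuous_subtype_val).prodMk
    ((continuous_mat_apply k l).comp continuous_subtype_val)

theorem IsPair.locallyCompactSpace {v : Fin 3 → ℝ} {i j k l : Fin 3} (h : IsPair v i j k l) :
    LocallyCompactSpace (stdRadical v) :=
  h.homeo.symm.isClosedEmbedding.locallyCompactSpace

theorem continuous_of_isSchwartz {φ : G ⧸ H → ℂ} (hφ : IsSchwartz φ) :
    Continuous fun g : G => φ (g : G ⧸ H) := IsSmooth.continuous hφ.1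

theorem measurable_enorm_of_isSchwartz {φ : G ⧸ H → ℂ} (hφ : IsSchwartz φ) (N : Subgroup G)
    (g : G) : Measurable fun n : N => ‖φ ((g * (n : G) : G) : G ⧸ H)‖ₑ :=
  ((continuous_of_isSchwartz hφ).comp
    (continuous_const.mul continuous_subtype_val)).enorm.measurable

/-- The integral over an abelian unipotent radical as an integral over `ℍ²`. -/
theorem IsPair.integralDiverges {v : Fin 3 → ℝ} {i j k l : Fin 3} (h : IsPair v i j k l)
    {φ : G ⧸ H → ℂ} (hφ : IsSchwartz φ) (g : G)
    (htop : ∫⁻ p, ‖φ ((g * h.elem p : G) : G ⧸ H)‖ₑ ∂(quatVol.prod quatVol) = ⊤) :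
    IntegralDiverges φ (stdRadical v) g := by
  intro μ hμ
  have := h.locallyCompactSpace
  refine lintegral_eq_top_of_homeomorph h.homeo (quatVol.prod quatVol) ?_ μ
    (measurable_enorm_of_isSchwartz hφ _ g) htop
  intro n f _
  obtain ⟨p, rfl⟩ := h.homeo.surjective n
  have e : ∀ x, h.homeo p * h.homeo x = h.homeo (p + x) := fun x =>
    Subtype.ext (h.elem_add p x).symm
  simp only [e]
  exact lintegral_add_left_eq_self (fun x => f (h.homeo x)) p

/-! ### Semidirect products with one root group -/

/-- `N_w` is the semidirect product of the root group at the position `(i,j)` and its normal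
subgroup `N_v`. -/
structure IsRootExtension (w v : Fin 3 → ℝ) (i j : Fin 3) : Prop where
  ne : i ≠ j
  lt : w j < w i
  eq : v i = v j
  le : ∀ a b, v b < v a → w b < w a
  or : ∀ a b, w b < w a → (a, b) = (i, j) ∨ v b < v a

theorem IsRootExtension.apply_eq {w v : Fin 3 → ℝ} {i j : Fin 3} (h : IsRootExtension w v i j)
    {n : G} (hn : n ∈ stdRadical w) {a b : Fin 3} (hab : v a ≤ v b) (hne : (a, b) ≠ (i, j)) :
    n.mat a b = (1 : Mat) a b :=
  mem_stdRadical.1 hn a b (le_of_not_gt fun h1 => (h.or a b h1).elim hne (not_lt.2 hab))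

theorem IsRootExtension.elem_mul_mem {w v : Fin 3 → ℝ} {i j : Fin 3}
    (h : IsRootExtension w v i j) {n : G} (hn : n ∈ stdRadical w) :
    elem i j h.ne (-n.mat i j) * n ∈ stdRadical v := by
  refine mem_stdRadical.2 fun a b hab => ?_
  rw [elem_mul_mat_apply]
  split_ifs with ha
  · subst ha
    have h1 : n.mat j b = (1 : Mat) j b :=
      h.apply_eq hn (h.eq ▸ hab) fun h2 => h.ne (congrArg Prod.fst h2).symm
    rw [h1]
    by_cases hb : b = j
    · subst hb
      rw [Matrix.one_apply_eq, mul_one, add_neg_cancel, Matrix.one_apply_ne h.ne]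
    · rw [Matrix.one_apply_ne (Ne.symm hb), mul_zero, add_zero]
      exact h.apply_eq hn hab fun h2 => hb (congrArg Prod.snd h2)
  · rw [add_zero]
    exact h.apply_eq hn hab fun h2 => ha (congrArg Prod.fst h2)

theorem IsRootExtension.elem_mul_mat_apply {w v : Fin 3 → ℝ} {i j : Fin 3}
    (h : IsRootExtension w v i j) (z : ℍ[ℝ]) {m : G} (hm : m ∈ stdRadical v) :
    (elem i j h.ne z * m).mat i j = z := by
  rw [SLThreeH.elem_mul_mat_apply, if_pos rfl, mem_stdRadical.1 hm i j h.eq.le,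
    mem_stdRadical.1 hm j j le_rfl, Matrix.one_apply_ne h.ne, Matrix.one_apply_eq, mul_one,
    zero_add]

theorem IsRootExtension.elem_mem {w v : Fin 3 → ℝ} {i j : Fin 3} (h : IsRootExtension w v i j)
    (z : ℍ[ℝ]) : elem i j h.ne z ∈ stdRadical w := by
  refine mem_stdRadical.2 fun a b hab => ?_
  rw [elem_mat, Matrix.add_apply, Matrix.single_apply, if_neg, add_zero]
  rintro ⟨rfl, rfl⟩
  exact not_lt.2 hab h.lt

theorem IsRootExtension.stdRadical_le {w v : Fin 3 → ℝ} {i j : Fin 3}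
    (h : IsRootExtension w v i j) : stdRadical v ≤ stdRadical w := fun _ hn =>
  mem_stdRadical.2 fun a b hab =>
    mem_stdRadical.1 hn a b (le_of_not_gt fun h1 => not_lt.2 hab (h.le a b h1))

/-- The coordinates `(z, m) ↦ (1 + z Eᵢⱼ) m` on `N_w`. -/
def IsRootExtension.homeo {w v : Fin 3 → ℝ} {i j : Fin 3} (h : IsRootExtension w v i j) :
    ℍ[ℝ] × stdRadical v ≃ₜ stdRadical w where
  toFun p := ⟨elem i j h.ne p.1 * p.2, mul_mem (h.elem_mem _) (h.stdRadical_le p.2.2)⟩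
  invFun n := ((n : G).mat i j, ⟨_, h.elem_mul_mem n.2⟩)
  left_inv p := by
    have h1 := h.elem_mul_mat_apply p.1 p.2.2
    refine Prod.ext h1 (Subtype.ext ?_)
    change elem i j h.ne (-(elem i j h.ne p.1 * (p.2 : G)).mat i j) * (elem i j h.ne p.1 * p.2) = p.2
    rw [h1, elem_neg, inv_mul_cancel_left]
  right_inv n := by
    refine Subtype.ext ?_
    change elem i j h.ne ((n : G).mat i j) * (elem i j h.ne (-(n : G).mat i j) * n) = n
    rw [elem_neg, mul_inv_cancel_left]
  continuous_toFun := Continuous.subtype_mk (((continuous_elem h.ne).comp continuous_fst).mul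
    (continuous_subtype_val.comp continuous_snd)) _
  continuous_invFun := by
    have h1 : Continuous fun n : stdRadical w => (n : G).mat i j :=
      (continuous_mat_apply i j).comp continuous_subtype_val
    exact h1.prodMk (Continuous.subtype_mk
      (((continuous_elem h.ne).comp h1.neg).mul continuous_subtype_val) _)

/-- If the integrals over `N_v` of all translates diverge, then so do those over `N_w`. The product
of Haar measures on the root group and on `N_v` is left invariant in the coordinates
`(z, m) ↦ (1 + z Eᵢⱼ) m`, because `N_v` is normal. -/
theorem IsRootExtension.integralDiverges {w v : Fin 3 → ℝ} {i j : Fin 3}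
    (h : IsRootExtension w v i j) [LocallyCompactSpace (stdRadical v)] {φ : G ⧸ H → ℂ}
    (hφ : IsSchwartz φ) (hv : ∀ g, IntegralDiverges φ (stdRadical v) g) (g : G) :
    IntegralDiverges φ (stdRadical w) g := by
  intro μ hμ
  have : LocallyCompactSpace (stdRadical w) :=
    h.homeo.symm.isClosedEmbedding.locallyCompactSpace
  let ν : Measure (stdRadical v) := Measure.haar
  have hF := measurable_enorm_of_isSchwartz hφ (stdRadical w) g
  have he : Measurable h.homeo := h.homeo.continuous.measurable
  refine lintegral_eq_top_of_homeomorph h.homeo (quatVol.prod ν) ?_ μ hF ?_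
  · intro n f hf
    obtain ⟨⟨z, m⟩, rfl⟩ := h.homeo.surjective n
    have hm : ∀ x : ℍ[ℝ], (elem i j h.ne x)⁻¹ * m * elem i j h.ne x ∈ stdRadical v := fun x => by
      have h1 := conj_mem_stdRadical (elem_mem_stdParabolic h.ne h.eq.ge (-x)) m.2
      rwa [elem_neg, inv_inv] at h1
    have e : ∀ x m', h.homeo (z, m) * h.homeo (x, m') = h.homeo (z + x, ⟨_, hm x⟩ * m') := by
      intro x m'
      refine Subtype.ext ?_
      change elem i j h.ne z * m * (elem i j h.ne x * m') = elem i j h.ne (z + x) *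
        ((elem i j h.ne x)⁻¹ * m * elem i j h.ne x * m')
      rw [elem_add]
      group
    have m1 : Measurable fun x => f (h.homeo (z, m) * h.homeo x) :=
      hf.comp ((measurable_const_mul _).comp he)
    have m2 : Measurable fun x => f (h.homeo x) := hf.comp he
    rw [lintegral_prod _ m1.aemeasurable, lintegral_prod _ m2.aemeasurable]
    simp only [e]
    refine Eq.trans ?_ (lintegral_add_left_eq_self (μ := quatVol)
      (fun x => ∫⁻ m', f (h.homeo (x, m')) ∂ν) z)
    refine lintegral_congr fun x => ?_
    exact lintegral_mul_left_eq_self (fun m' => f (h.homeo (z + x, m'))) _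
  · have m3 : Measurable fun x => ‖φ ((g * (h.homeo x : G) : G) : G ⧸ H)‖ₑ := hF.comp he
    rw [lintegral_prod _ m3.aemeasurable]
    have h1 : ∀ z : ℍ[ℝ],
        ∫⁻ m, ‖φ ((g * (h.homeo (z, m) : G) : G) : G ⧸ H)‖ₑ ∂ν = ⊤ := by
      intro z
      have h2 := hv (g * elem i j h.ne z) ν inferInstance
      simp only [mul_assoc] at h2
      exact h2
    rw [lintegral_congr h1]
    simp

/-! ### Conjugation by elements of `H` -/

theorem integralDiverges_conj {φ : G ⧸ H → ℂ} {N : Subgroup G} {g h : G} (hh : h ∈ H)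
    (hN : IntegralDiverges φ N (g * h)) : IntegralDiverges φ (conj h N) g := by
  intro μ hμ
  let c : N ≃* conj h N := MulEquiv.subgroupMap (MulAut.conj h) N
  have hc : Continuous c := Continuous.subtype_mk
    ((continuous_const.mul continuous_subtype_val).mul continuous_const) _
  have hc' : Continuous c.symm := by
    refine continuous_induced_rng.2 ?_
    have e : ((↑) : N → G) ∘ c.symm = fun m : conj h N => h⁻¹ * (m : G) * h := by
      funext m
      obtain ⟨n, rfl⟩ := c.surjective m
      change ((c.symm (c n) : N) : G) = h⁻¹ * (h * (n : G) * h⁻¹) * h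
      rw [MulEquiv.symm_apply_apply]
      group
    rw [e]
    exact (continuous_const.mul continuous_subtype_val).mul continuous_const
  have h1 := hN (μ.map c.symm) (MulEquiv.isHaarMeasure_map μ c.symm hc' hc)
  let c' : conj h N ≃ₜ N := { c.symm.toEquiv with
    continuous_toFun := hc'
    continuous_invFun := hc }
  have h2 : ∫⁻ n : N, ‖φ ((g * h * (n : G) : G) : G ⧸ H)‖ₑ ∂(μ.map c'.toMeasurableEquiv) = ⊤ := h1
  rw [lintegral_map_equiv] at h2
  rw [← h2]
  refine lintegral_congr fun m => ?_
  obtain ⟨n, rfl⟩ := c.surjective m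
  have e : c'.toMeasurableEquiv (c n) = n := c.symm_apply_apply n
  rw [e]
  change ‖φ ((g * (h * (n : G) * h⁻¹) : G) : G ⧸ H)‖ₑ = _
  congr 2
  refine QuotientGroup.eq.2 ?_
  have e2 : (g * (h * (n : G) * h⁻¹))⁻¹ * (g * h * n) = h := by group
  rw [e2]
  exact hh

theorem integralDiverges_conj_iff {φ : G ⧸ H → ℂ} {N : Subgroup G} {g h : G} (hh : h ∈ H) :
    IntegralDiverges φ (conj h N) g ↔ IntegralDiverges φ N (g * h) := by
  refine ⟨fun h1 => ?_, integralDiverges_conj hh⟩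
  have h2 : IntegralDiverges φ (conj h N) (g * h * h⁻¹) := by rwa [mul_inv_cancel_right]
  have h3 := integralDiverges_conj (inv_mem hh) h2
  rwa [conj_conj, inv_mul_cancel, conj_one] at h3

/-! ### Divergence of the integrals over the unipotent radicals of `Q₁` and `Q₄` -/

theorem isPair_Q₁ : IsPair ![1, 1, 0] 0 2 1 2 where
  ij := by decide
  kl := by decide
  jk := by decide
  li := by decide
  ne := by decide
  iff a b := by fin_cases a <;> fin_cases b <;> simp

theorem isPair_Q₄ : IsPair ![0, 1, 0] 1 0 1 2 where
  ij := by decide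
  kl := by decide
  jk := by decide
  li := by decide
  ne := by decide
  iff a b := by fin_cases a <;> fin_cases b <;> simp

theorem frobSq_le {A : Mat} {c : ℝ} (h : ∀ i j, ‖A i j‖ ≤ c) : frobSq A ≤ 9 * c ^ 2 := by
  calc frobSq A ≤ ∑ _i : Fin 3, ∑ _j : Fin 3, c ^ 2 := by
        refine Finset.sum_le_sum fun i _ => Finset.sum_le_sum fun j _ => ?_
        have := h i j
        gcongr
    _ = 9 * c ^ 2 := by simp; ring

theorem IsPair.elem_neg {v : Fin 3 → ℝ} {i j k l : Fin 3} (h : IsPair v i j k l)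
    (p : ℍ[ℝ] × ℍ[ℝ]) : h.elem (-p) = (h.elem p)⁻¹ := by
  rw [eq_inv_iff_mul_eq_one, ← h.elem_add, neg_add_cancel]
  apply G.mat_injective
  simp [h.elem_mat]

theorem isPair_Q₁_elem_mat (x y : ℍ[ℝ]) :
    (isPair_Q₁.elem (x, y)).mat = !![1, 0, x; 0, 1, y; 0, 0, 1] := by
  refine Matrix.ext fun i j => ?_
  rw [IsPair.elem_mat_apply]
  fin_cases i <;> fin_cases j <;> simp

theorem isPair_Q₄_elem_mat (x y : ℍ[ℝ]) :
    (isPair_Q₄.elem (x, y)).mat = !![1, 0, 0; x, 1, y; 0, 0, 1] := by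
  refine Matrix.ext fun i j => ?_
  rw [IsPair.elem_mat_apply]
  fin_cases i <;> fin_cases j <;> simp

theorem star_fin_three (a b c d e f g h i : ℍ[ℝ]) :
    star (!![a, b, c; d, e, f; g, h, i] : Mat) =
      !![star a, star d, star g; star b, star e, star h; star c, star f, star i] := by
  refine Matrix.ext fun i j => ?_
  rw [Matrix.star_apply]
  fin_cases i <;> fin_cases j <;> rfl

theorem J_eq : (J : Mat) = !![1, 0, 0; 0, -1, 0; 0, 0, -1] := by
  refine Matrix.ext fun i j => ?_
  rw [J_val]
  fin_cases i <;> fin_cases j <;> simp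

theorem herm_Q₁ (x y : ℍ[ℝ]) : herm (isPair_Q₁.elem (x, y)) =
    !![1 - x * star x, -(x * star y), -x; -(y * star x), -1 - y * star y, -y;
      -star x, -star y, -1] := by
  rw [herm, isPair_Q₁_elem_mat, star_fin_three, J_eq]
  refine Matrix.ext fun i j => ?_
  fin_cases i <;> fin_cases j <;> simp [Matrix.mul_apply, Fin.sum_univ_three, sub_eq_add_neg]

theorem hermInv_Q₁ (x y : ℍ[ℝ]) : hermInv (isPair_Q₁.elem (x, y)) =
    !![1, 0, -x; 0, -1, y; -star x, star y, star x * x - star y * y - 1] := by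
  rw [hermInv, ← IsPair.elem_neg, Prod.neg_mk, isPair_Q₁_elem_mat, star_fin_three, J_eq]
  refine Matrix.ext fun i j => ?_
  fin_cases i <;> fin_cases j <;> simp [Matrix.mul_apply, Fin.sum_univ_three, sub_eq_add_neg]

theorem herm_Q₄ (x y : ℍ[ℝ]) : herm (isPair_Q₄.elem (x, y)) =
    !![1, star x, 0; x, x * star x - y * star y - 1, -y; 0, -star y, -1] := by
  rw [herm, isPair_Q₄_elem_mat, star_fin_three, J_eq]
  refine Matrix.ext fun i j => ?_
  fin_cases i <;> fin_cases j <;>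
    simp [Matrix.mul_apply, Fin.sum_univ_three, sub_eq_add_neg, add_right_comm]

theorem hermInv_Q₄ (x y : ℍ[ℝ]) : hermInv (isPair_Q₄.elem (x, y)) =
    !![1 - star x * x, star x, -(star x * y); x, -1, y;
      -(star y * x), star y, -1 - star y * y] := by
  rw [hermInv, ← IsPair.elem_neg, Prod.neg_mk, isPair_Q₄_elem_mat, star_fin_three, J_eq]
  refine Matrix.ext fun i j => ?_
  fin_cases i <;> fin_cases j <;>
    simp [Matrix.mul_apply, Fin.sum_univ_three, sub_eq_add_neg, add_comm]

theorem norm_normSq_sub_le {x y : ℍ[ℝ]} (h1 : ‖x‖ ≤ ‖y‖) (h2 : ‖y‖ < ‖x‖ + 1) :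
    ‖((Quaternion.normSq x : ℝ) : ℍ[ℝ]) - ((Quaternion.normSq y : ℝ) : ℍ[ℝ]) - 1‖ ≤
      2 * (1 + ‖x‖) := by
  have e : ((Quaternion.normSq x : ℝ) : ℍ[ℝ]) - ((Quaternion.normSq y : ℝ) : ℍ[ℝ]) - 1 =
      ((‖x‖ * ‖x‖ - ‖y‖ * ‖y‖ - 1 : ℝ) : ℍ[ℝ]) := by
    rw [Quaternion.normSq_eq_norm_mul_self, Quaternion.normSq_eq_norm_mul_self]
    push_cast
    rfl
  have hx := norm_nonneg x
  rw [e, Quaternion.norm_coe, Real.norm_eq_abs, abs_le]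
  constructor <;> nlinarith

theorem norm_one_add_mul_le {x a : ℍ[ℝ]} {R : ℝ} (hR : 0 ≤ R) (hx : ‖x‖ ≤ 1 + R)
    (ha : ‖a‖ = 1) {y : ℍ[ℝ]} (hy : ‖y‖ ≤ 1 + R) : ‖a - x * y‖ ≤ 2 * (1 + R) ^ 2 := by
  calc ‖a - x * y‖ ≤ ‖a‖ + ‖x‖ * ‖y‖ := (norm_sub_le _ _).trans_eq (by rw [norm_mul])
    _ ≤ 1 + (1 + R) * (1 + R) := by rw [ha]; gcongr
    _ ≤ _ := by nlinarith

/-- Near the cone `‖x‖ = ‖y‖` one of `Y` and `Y⁻¹` grows quadratically, the other only linearly. -/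
theorem size_Q₁_le {x y : ℍ[ℝ]} (h1 : ‖x‖ ≤ ‖y‖) (h2 : ‖y‖ < ‖x‖ + 1) :
    size (isPair_Q₁.elem (x, y)) ≤ 1296 * (1 + ‖x‖) ^ 6 := by
  have hx := norm_nonneg x
  have hx1 : ‖x‖ ≤ 1 + ‖x‖ := by linarith
  have hy1 : ‖y‖ ≤ 1 + ‖x‖ := by linarith
  have hsx : ‖star x‖ ≤ 1 + ‖x‖ := by rwa [norm_star]
  have hsy : ‖star y‖ ≤ 1 + ‖x‖ := by rwa [norm_star]
  have b1 := frobSq_le (A := herm (isPair_Q₁.elem (x, y))) (c := 2 * (1 + ‖x‖) ^ 2) (by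
    have q1 := norm_one_add_mul_le hx hx1 norm_one hsx
    have q2 := norm_one_add_mul_le (a := -1) hx hy1 (by simp) hsy
    have q3 : ‖x‖ * ‖y‖ ≤ (1 + ‖x‖) * (1 + ‖x‖) := by gcongr
    rw [herm_Q₁]
    intro i j
    fin_cases i <;> fin_cases j <;> simp <;> first | assumption | nlinarith)
  have b2 := frobSq_le (A := hermInv (isPair_Q₁.elem (x, y))) (c := 2 * (1 + ‖x‖)) (by
    have q1 := norm_normSq_sub_le h1 h2
    rw [hermInv_Q₁]
    intro i j
    fin_cases i <;> fin_cases j <;>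
      simp [Quaternion.star_mul_self] <;> first | assumption | linarith)
  calc size (isPair_Q₁.elem (x, y)) ≤ 9 * (2 * (1 + ‖x‖) ^ 2) ^ 2 * (9 * (2 * (1 + ‖x‖)) ^ 2) :=
        mul_le_mul b1 b2 (frobSq_nonneg _) (by positivity)
    _ = _ := by ring

theorem size_Q₄_le {x y : ℍ[ℝ]} (h1 : ‖x‖ ≤ ‖y‖) (h2 : ‖y‖ < ‖x‖ + 1) :
    size (isPair_Q₄.elem (x, y)) ≤ 1296 * (1 + ‖x‖) ^ 6 := by
  have hx := norm_nonneg x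
  have hx1 : ‖x‖ ≤ 1 + ‖x‖ := by linarith
  have hy1 : ‖y‖ ≤ 1 + ‖x‖ := by linarith
  have hsx : ‖star x‖ ≤ 1 + ‖x‖ := by rwa [norm_star]
  have hsy : ‖star y‖ ≤ 1 + ‖x‖ := by rwa [norm_star]
  have b1 := frobSq_le (A := herm (isPair_Q₄.elem (x, y))) (c := 2 * (1 + ‖x‖)) (by
    have q1 := norm_normSq_sub_le h1 h2
    rw [herm_Q₄]
    intro i j
    fin_cases i <;> fin_cases j <;>
      simp [Quaternion.self_mul_star] <;> first | assumption | linarith)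
  have b2 := frobSq_le (A := hermInv (isPair_Q₄.elem (x, y))) (c := 2 * (1 + ‖x‖) ^ 2) (by
    have q1 := norm_one_add_mul_le hx hsx norm_one hx1
    have q2 := norm_one_add_mul_le (a := -1) hx hsy (by simp) hy1
    have q3 : ‖x‖ * ‖y‖ ≤ (1 + ‖x‖) * (1 + ‖x‖) := by gcongr
    rw [hermInv_Q₄]
    intro i j
    fin_cases i <;> fin_cases j <;> simp <;> first | assumption | nlinarith)
  calc size (isPair_Q₄.elem (x, y)) ≤ 9 * (2 * (1 + ‖x‖)) ^ 2 * (9 * (2 * (1 + ‖x‖) ^ 2) ^ 2) :=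
        mul_le_mul b1 b2 (frobSq_nonneg _) (by positivity)
    _ = _ := by ring

theorem IsPair.integralDiverges_witness {v : Fin 3 → ℝ} {i j k l : Fin 3} (h : IsPair v i j k l)
    (hs : ∀ x y : ℍ[ℝ], ‖x‖ ≤ ‖y‖ → ‖y‖ < ‖x‖ + 1 →
      size (h.elem (x, y)) ≤ 1296 * (1 + ‖x‖) ^ 6) (g : G) :
    IntegralDiverges witness (stdRadical v) g := by
  refine h.integralDiverges isSchwartz_witness g ?_
  set C : ℝ := (frobSq g.mat * frobSq (g⁻¹).mat) ^ 2 + 1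
  have hC : 0 < C := by positivity
  have hF := (measurable_enorm_of_isSchwartz isSchwartz_witness (stdRadical v) g).comp
    h.homeo.continuous.measurable
  refine lintegral_eq_top_of_le hF (c := (C * 1296) ^ (-(7 / 6) : ℝ)) (by positivity) ?_
  intro x y h1 h2
  have hx : 0 ≤ 1 + ‖x‖ := by positivity
  have h3 : size (g * h.elem (x, y)) ≤ C * 1296 * (1 + ‖x‖) ^ 6 := by
    have h4 := hs x y h1 h2
    have h5 := size_pos (h.elem (x, y))
    calc _ ≤ (frobSq g.mat * frobSq (g⁻¹).mat) ^ 2 * size (h.elem (x, y)) := size_mul_le _ _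
      _ ≤ C * (1296 * (1 + ‖x‖) ^ 6) := by
          gcongr
          simp [C]
      _ = _ := by ring
  have h6 : (C * 1296) ^ (-(7 / 6) : ℝ) * (1 + ‖x‖) ^ (-7 : ℝ) ≤ sizePow (g * h.elem (x, y)) := by
    calc _ = (C * 1296 * (1 + ‖x‖) ^ 6) ^ (-(7 / 6) : ℝ) := by
          have e : ((1 + ‖x‖) ^ 6) ^ (-(7 / 6) : ℝ) = (1 + ‖x‖) ^ (-7 : ℝ) := by
            rw [← Real.rpow_natCast (1 + ‖x‖) 6, ← Real.rpow_mul hx]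
            norm_num
          rw [Real.mul_rpow (x := C * 1296) (y := (1 + ‖x‖) ^ 6) (by positivity) (by positivity), e]
      _ ≤ _ := Real.rpow_le_rpow_of_nonpos (size_pos _) h3 (by norm_num)
  change _ ≤ ‖witness ((g * h.elem (x, y) : G) : G ⧸ H)‖ₑ
  rw [witness_mk, ← ofReal_norm, Complex.norm_real, Real.norm_of_nonneg (sizePow_pos _).le]
  exact ENNReal.ofReal_le_ofReal h6

theorem isDivergentSchwartz_witness : IsDivergentSchwartz witness := by
  refine ⟨isSchwartz_witness, isPositive_witness, ?_⟩
  rintro Q ⟨h, hh, rfl | rfl⟩ g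
  · rw [unipotentRadical_conj, Q₁, unipotentRadical_stdParabolic, integralDiverges_conj_iff hh]
    exact isPair_Q₁.integralDiverges_witness (fun _ _ => size_Q₁_le) _
  · rw [unipotentRadical_conj, Q₄, unipotentRadical_stdParabolic, integralDiverges_conj_iff hh]
    exact isPair_Q₄.integralDiverges_witness (fun _ _ => size_Q₄_le) _

/-! ### Normalizers of standard minimal parabolic subgroups -/

theorem mul_elem_mat_apply {i j : Fin 3} (h : i ≠ j) (q : ℍ[ℝ]) (g : G) (a b : Fin 3) :
    (g * elem i j h q).mat a b = g.mat a b + if b = j then g.mat a i * q else 0 := by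
  rw [G.mat_mul, elem_mat, mul_add, mul_one, Matrix.add_apply]
  congr 1
  split_ifs with hb
  · rw [hb, Matrix.mul_single_apply_same]
  · rw [Matrix.mul_single_apply_of_ne _ _ _ _ _ hb]

/-- The normalizer of `P_v` fixes the line stabilized by `P_v`, if there is one: if the `k`-th
column of `s` has a nonzero entry at `j ≠ k`, it is no eigenvector of `1 + Eₖⱼ ∈ P_v`. -/
theorem apply_max_eq_zero_of_normalizes {v : Fin 3 → ℝ} {s : G}
    (hs : ∀ g ∈ stdParabolic v, s⁻¹ * g * s ∈ stdParabolic v) {k : Fin 3}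
    (hk : ∀ j, j ≠ k → v j < v k) {j : Fin 3} (hj : j ≠ k) : s.mat j k = 0 := by
  have ht := hs _ (elem_mem_stdParabolic hj.symm (hk j hj).le 1)
  set t := s⁻¹ * elem k j hj.symm 1 * s with ht_def
  have e : elem k j hj.symm 1 * s = s * t := by rw [ht_def]; group
  have h1 : ∀ a, (s * t).mat a k = s.mat a k * t.mat k k := by
    intro a
    rw [G.mat_mul, Matrix.mul_apply, Finset.sum_eq_single k]
    · intro l _ hl
      rw [(ht l k (hk l hl)).1, mul_zero]
    · simp
  have h2 := h1 j
  have h3 := h1 k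
  rw [← e, elem_mul_mat_apply, if_neg hj, add_zero] at h2
  rw [← e, elem_mul_mat_apply, if_pos rfl, one_mul] at h3
  by_contra hne
  have h4 : t.mat k k = 1 := by
    have : s.mat j k * (t.mat k k - 1) = 0 := by rw [mul_sub, ← h2, mul_one, sub_self]
    exact sub_eq_zero.1 ((mul_eq_zero.1 this).resolve_left hne)
  rw [h4, mul_one] at h3
  exact hne (by simpa using h3)

theorem apply_min_eq_zero_of_normalizes {v : Fin 3 → ℝ} {s : G}
    (hs : ∀ g ∈ stdParabolic v, s * g * s⁻¹ ∈ stdParabolic v) {r : Fin 3}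
    (hr : ∀ j, j ≠ r → v r < v j) {j : Fin 3} (hj : j ≠ r) : s.mat r j = 0 := by
  have ht := hs _ (elem_mem_stdParabolic hj (hr j hj).le 1)
  set t := s * elem j r hj 1 * s⁻¹ with ht_def
  have e : s * elem j r hj 1 = t * s := by rw [ht_def]; group
  have h1 : ∀ a, (t * s).mat r a = t.mat r r * s.mat r a := by
    intro a
    rw [G.mat_mul, Matrix.mul_apply, Finset.sum_eq_single r]
    · intro l _ hl
      rw [(ht r l (hr l hl)).1, zero_mul]
    · simp
  have h2 := h1 j
  have h3 := h1 r
  rw [← e, mul_elem_mat_apply, if_neg hj, add_zero] at h2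
  rw [← e, mul_elem_mat_apply, if_pos rfl, mul_one] at h3
  by_contra hne
  have h4 : t.mat r r = 1 := by
    have : (t.mat r r - 1) * s.mat r j = 0 := by rw [sub_mul, ← h2, one_mul, sub_self]
    exact sub_eq_zero.1 ((mul_eq_zero.1 this).resolve_right hne)
  rw [h4, one_mul] at h3
  exact hne (by simpa using h3)

theorem conj_stdParabolic_of_mem {v : Fin 3 → ℝ} {c : G} (hc : c ∈ stdParabolic v) :
    conj c (stdParabolic v) = stdParabolic v := by
  ext g
  rw [mem_conj, Subgroup.mul_mem_cancel_right _ hc,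
    Subgroup.mul_mem_cancel_left _ (inv_mem hc)]

/-! ### Minimal `σ`-parabolic subgroups -/

/-- Every weight is refined by one that takes three distinct values. -/
theorem exists_injective_refinement (v : Fin 3 → ℝ) :
    ∃ v' : Fin 3 → ℝ, Function.Injective v' ∧ ∀ i j, v i < v j → v' i < v' j := by
  let key : Fin 3 → ℝ ×ₗ Fin 3 := fun i => toLex (v i, i)
  let r : Fin 3 → ℕ := fun i => (Finset.univ.filter fun j => key j < key i).card
  have hr : ∀ i j, key i < key j → r i < r j := by
    intro i j hij
    refine Finset.card_lt_card (Finset.ssubset_iff_of_subset ?_ |>.2 ⟨i, ?_, ?_⟩)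
    · intro a ha
      simp only [Finset.mem_filter, Finset.mem_univ, true_and] at ha ⊢
      exact ha.trans hij
    · simpa using hij
    · simp
  have hkey : Function.Injective key := fun i j h => congrArg (fun x => (ofLex x).2) h
  refine ⟨fun i => (r i : ℝ), fun i j h => ?_, fun i j h => ?_⟩
  · have h' : r i = r j := Nat.cast_injective (R := ℝ) h
    by_contra hne
    rcases lt_or_gt_of_ne (hkey.ne hne) with h1 | h1
    · exact (hr _ _ h1).ne h'
    · exact (hr _ _ h1).ne' h'
  · exact Nat.cast_lt.2 (hr i j (Prod.Lex.toLex_lt_toLex.2 (Or.inl h)))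

theorem injective_of_minimal {y : G} {v : Fin 3 → ℝ}
    (h : Minimal IsParabolic (conj y (stdParabolic v))) : Function.Injective v := by
  obtain ⟨v', hinj, hv'⟩ := exists_injective_refinement v
  have hle : stdParabolic v' ≤ stdParabolic v := fun g hg i j hij => hg i j (hv' i j hij)
  have h1 : stdParabolic v ≤ stdParabolic v' := by
    have h2 := conj_mono y⁻¹ (h.2 ⟨y, v', rfl⟩ (conj_mono y hle))
    rwa [conj_conj, conj_conj, inv_mul_cancel, conj_one, conj_one] at h2
  have key : ∀ i j, i ≠ j → v i = v j → ¬ v' i < v' j := by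
    intro i j hij hv hlt
    have h3 := (h1 (elem_mem_stdParabolic hij hv.ge 1) i j hlt).1
    rw [elem_mat, Matrix.add_apply, Matrix.one_apply_ne hij, Matrix.single_apply_same,
      zero_add] at h3
    exact one_ne_zero h3
  intro i j hij
  by_contra hne
  rcases lt_or_gt_of_ne (hinj.ne hne) with h3 | h3
  · exact key i j hne hij h3
  · exact key j i (Ne.symm hne) hij.symm h3

theorem sigma_sigma (g : G) : sigma (sigma g) = g := by
  apply G.mat_injective
  rw [mat_sigma, ← map_inv, mat_sigma, inv_inv, star_mul, star_mul, star_star, star_J]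
  simp [mul_assoc]

theorem sigma_mem_stdParabolic {v : Fin 3 → ℝ} {g : G} (hg : g ∈ stdParabolic v) :
    sigma g ∈ stdParabolic (-v) := by
  have key : ∀ A : Mat, ∀ i j, A j i = 0 → ((J : Mat) * star A * J) i j = 0 := by
    intro A i j h
    rw [J_val, Matrix.mul_diagonal, Matrix.diagonal_mul, Matrix.star_apply, h, star_zero,
      mul_zero, zero_mul]
  intro i j hij
  have hji : v j < v i := by simpa using hij
  rw [← map_inv, mat_sigma, mat_sigma, inv_inv]
  exact ⟨key _ i j (hg j i hji).2, key _ i j (hg j i hji).1⟩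

theorem map_sigma_conj_stdParabolic (y : G) (v : Fin 3 → ℝ) :
    (conj y (stdParabolic v)).map sigma = conj (sigma y) (stdParabolic (-v)) := by
  ext g
  rw [Subgroup.mem_map, mem_conj]
  constructor
  · rintro ⟨x, hx, rfl⟩
    have h := sigma_mem_stdParabolic (mem_conj.1 hx)
    simpa using h
  · intro h
    refine ⟨sigma g, mem_conj.2 ?_, sigma_sigma g⟩
    have h2 := sigma_mem_stdParabolic h
    simpa [sigma_sigma] using h2

theorem conj_permElem_stdParabolic (π : Equiv.Perm (Fin 3)) (v : Fin 3 → ℝ) :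
    conj (permElem π) (stdParabolic v) = stdParabolic (v ∘ π) := by
  have key : ∀ (x : G) i j,
      x.mat i j = ((permElem π)⁻¹ * x * permElem π).mat (π i) (π j) := by
    intro x i j
    have e : permElem π * ((permElem π)⁻¹ * x * permElem π) * (permElem π)⁻¹ = x := by group
    rw [← permElem_mul_mul_inv π ((permElem π)⁻¹ * x * permElem π).mat i j]
    exact congrFun (congrFun (congrArg G.mat e.symm) i) j
  have key' : ∀ (x : G) i j,
      (x⁻¹).mat i j = (((permElem π)⁻¹ * x * permElem π)⁻¹).mat (π i) (π j) := by
    intro x i j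
    have e : ((permElem π)⁻¹ * x * permElem π)⁻¹ = (permElem π)⁻¹ * x⁻¹ * permElem π := by
      simp only [mul_inv_rev, inv_inv, mul_assoc]
    rw [e, key x⁻¹ i j]
  ext g
  rw [mem_conj]
  constructor
  · intro h i j hij
    rw [key, key']
    exact h _ _ hij
  · intro h i j hij
    have h1 := h (π.symm i) (π.symm j) (by simpa using hij)
    rw [key, key'] at h1
    simpa using h1

/-- If `y P_v y⁻¹` is minimal and `y P_{-v} y⁻¹` is its image under `σ`, then `y⁻¹ σ(y)` normalizes
`P_{-v}`, and the hermitian matrix `y⁻¹ J (y⁻¹)† = y⁻¹ σ(y) J` is diagonal. -/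
theorem inv_mul_J_mul_star_inv_apply_eq_zero {y : G} {v : Fin 3 → ℝ} (hv : Function.Injective v)
    (h : (conj y (stdParabolic v)).map sigma = conj y (stdParabolic (-v))) {i j : Fin 3}
    (hij : i ≠ j) : ((y⁻¹).mat * J * star (y⁻¹).mat) i j = 0 := by
  set s := y⁻¹ * sigma y with hs
  have h1 : conj s (stdParabolic (-v)) = stdParabolic (-v) := by
    rw [hs, ← conj_conj, ← map_sigma_conj_stdParabolic, h, conj_conj, inv_mul_cancel, conj_one]
  have h2 : ∀ g ∈ stdParabolic (-v), s⁻¹ * g * s ∈ stdParabolic (-v) := fun g hg =>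
    mem_conj.1 (h1.symm ▸ hg)
  have h3 : ∀ g ∈ stdParabolic (-v), s * g * s⁻¹ ∈ stdParabolic (-v) := fun g hg => by
    rw [← h1, mem_conj]
    have e : s⁻¹ * (s * g * s⁻¹) * s = g := by group
    rwa [e]
  have hinj : Function.Injective (-v) := fun a b hab => hv (neg_injective hab)
  obtain ⟨k, hk⟩ := Finite.exists_max (-v)
  obtain ⟨r, hr⟩ := Finite.exists_min (-v)
  have hk' : ∀ j, j ≠ k → (-v) j < (-v) k := fun j hj => (hk j).lt_of_ne (hinj.ne hj)
  have hr' : ∀ j, j ≠ r → (-v) r < (-v) j := fun j hj => (hr j).lt_of_ne (hinj.ne hj.symm)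
  have hkr : k ≠ r := by
    rintro rfl
    obtain ⟨j, hj⟩ := exists_ne k
    exact lt_asymm (hk' j hj) (hr' j hj)
  set E := (y⁻¹).mat * J * star (y⁻¹).mat with hE
  have hsE : E = s.mat * J := by
    rw [hs, G.mat_mul, mat_sigma, hE]
    simp [mul_assoc]
  have hstar : star E = E := by
    rw [hE, star_mul, star_mul, star_star, star_J, mul_assoc]
  have h4 : ∀ a b, a ≠ b → (b = k ∨ a = r) → E a b = 0 := by
    intro a b hab hc
    rw [hsE, J_val, Matrix.mul_diagonal]
    rcases hc with rfl | rfl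
    · rw [apply_max_eq_zero_of_normalizes h2 hk' hab, zero_mul]
    · rw [apply_min_eq_zero_of_normalizes h3 hr' hab.symm, zero_mul]
  have h5 : ∀ a b, a ≠ b → (b = k ∨ a = r) → E b a = 0 := by
    intro a b hab hc
    rw [← hstar, Matrix.star_apply, h4 a b hab hc, star_zero]
  by_cases c1 : j = k ∨ i = r
  · exact h4 i j hij c1
  · exact h5 j i hij.symm (by omega)

/-- Sylvester's law of inertia for the signature `(1,2)`: at most one sign is positive. -/
theorem eq_of_pos_of_pos {k : Mat} {ε : Fin 3 → ℝ}
    (h : k * J * star k = Matrix.diagonal fun i => ((ε i : ℝ) : ℍ[ℝ])) {i j : Fin 3}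
    (hi : ε i = 1) (hj : ε j = 1) : i = j := by
  by_contra hij
  have entry : ∀ a b, (k * J * star k) a b =
      k a 0 * star (k b 0) - k a 1 * star (k b 1) - k a 2 * star (k b 2) := by
    intro a b
    rw [Matrix.mul_apply, Fin.sum_univ_three, J_val]
    simp [Matrix.star_apply, sub_eq_add_neg]
  have diag : ∀ a, ε a = 1 → ‖k a 0‖ ^ 2 = 1 + ‖k a 1‖ ^ 2 + ‖k a 2‖ ^ 2 := by
    intro a ha
    have h1 := entry a a
    rw [h, Matrix.diagonal_apply_eq, ha] at h1
    have h2 := congrArg (fun q : ℍ[ℝ] => q.re) h1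
    simp only [Quaternion.self_mul_star, Quaternion.re_sub, Quaternion.re_coe,
      Quaternion.normSq_eq_norm_mul_self] at h2
    linarith
  have h0 := entry i j
  rw [h, Matrix.diagonal_apply_ne _ hij] at h0
  have h1 : k i 0 * star (k j 0) = k i 1 * star (k j 1) + k i 2 * star (k j 2) := by
    rw [sub_sub] at h0
    exact (sub_eq_zero.1 h0.symm)
  have h2 : ‖k i 0‖ * ‖k j 0‖ ≤ ‖k i 1‖ * ‖k j 1‖ + ‖k i 2‖ * ‖k j 2‖ := by
    have h3 := congrArg norm h1
    rw [norm_mul, norm_star] at h3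
    rw [h3]
    refine (norm_add_le _ _).trans_eq ?_
    rw [norm_mul, norm_mul, norm_star, norm_star]
  have di := diag i hi
  have dj := diag j hj
  have h0 : 0 ≤ ‖k i 0‖ * ‖k j 0‖ := by positivity
  generalize ‖k i 0‖ = a0 at *
  generalize ‖k j 0‖ = b0 at *
  have ha1 := norm_nonneg (k i 1)
  have ha2 := norm_nonneg (k i 2)
  have hb1 := norm_nonneg (k j 1)
  have hb2 := norm_nonneg (k j 2)
  generalize ‖k i 1‖ = a1 at *
  generalize ‖k i 2‖ = a2 at *
  generalize ‖k j 1‖ = b1 at *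
  generalize ‖k j 2‖ = b2 at *
  -- Cauchy-Schwarz for `(a1, a2)` and `(b1, b2)`
  have h4 : (a1 * b1 + a2 * b2) ^ 2 < (a0 * b0) ^ 2 := by
    rw [mul_pow, di, dj]
    nlinarith [sq_nonneg (a1 * b2 - a2 * b1), sq_nonneg a1, sq_nonneg a2, sq_nonneg b1,
      sq_nonneg b2]
  exact absurd (pow_le_pow_left₀ h0 h2 2) (not_le.2 h4)

/-- At least one sign is positive. -/
theorem exists_pos {k : Mat} {ε : Fin 3 → ℝ} (hε : ∀ i, ε i = 1 ∨ ε i = -1)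
    (h : k * (Matrix.diagonal fun i => ((ε i : ℝ) : ℍ[ℝ])) * star k = J) : ∃ i, ε i = 1 := by
  by_contra! hne
  have h1 : ∀ i, ε i = -1 := fun i => (hε i).resolve_left (hne i)
  have h2 := congrArg (fun A : Mat => (A 0 0).re) h
  simp only [h1, Matrix.mul_apply (M := k * Matrix.diagonal _), Matrix.mul_diagonal,
    Matrix.star_apply, Fin.sum_univ_three, J_val] at h2
  simp only [Quaternion.coe_neg, Quaternion.coe_one, mul_neg, mul_one, neg_mul,
    Quaternion.self_mul_star, Quaternion.re_add, Quaternion.re_neg, Quaternion.re_coe,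
    Matrix.diagonal_apply_eq, Matrix.cons_val_zero, Quaternion.re_one] at h2
  have h3 := fun j => Quaternion.normSq_nonneg (a := k 0 j)
  linarith [h3 0, h3 1, h3 2]

theorem exists_perm {v : Fin 3 → ℝ} (hv : Function.Injective v) (i : Fin 3) :
    ∃ π : Equiv.Perm (Fin 3), π 0 = i ∧ v (π 2) < v (π 1) := by
  set τ := Equiv.swap 0 i with hτ
  have h0 : τ 0 = i := Equiv.swap_apply_left 0 i
  have hne : v (τ 1) ≠ v (τ 2) := fun h => by
    have := τ.injective (hv h)
    exact absurd this (by decide)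
  rcases lt_or_gt_of_ne hne with h | h
  · refine ⟨(Equiv.swap 1 2).trans τ, ?_, ?_⟩
    · rw [Equiv.trans_apply, Equiv.swap_apply_of_ne_of_ne zero_ne_one (by decide : (0 : Fin 3) ≠ 2),
        h0]
    · rwa [Equiv.trans_apply, Equiv.trans_apply, Equiv.swap_apply_left, Equiv.swap_apply_right]
  · exact ⟨τ, h0, h⟩

theorem studyDet_J : studyDet (J : Mat) = 1 := by
  have h : (J : Mat) = Matrix.diagonal fun i => (((![1, -1, -1] : Fin 3 → ℝ) i : ℝ) : ℍ[ℝ]) := by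
    rw [J_val]
    congr 1
    funext i
    fin_cases i <;> simp
  rw [h, studyDet_diagonal]
  simp [Fin.prod_univ_three]

/-- A diagonal matrix of the form `g J g†` with `g ∈ G` becomes `diag(±1)` after rescaling. -/
theorem exists_rescaling {g : G}
    (hg : ∀ i j, i ≠ j → (g.mat * J * star g.mat) i j = 0) :
    ∃ (c : G) (ε : Fin 3 → ℝ), (∀ v, c ∈ stdParabolic v) ∧ (∀ i, ε i = 1 ∨ ε i = -1) ∧
      (c * g).mat * J * star (c * g).mat = Matrix.diagonal fun i => ((ε i : ℝ) : ℍ[ℝ]) := by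
  set E := g.mat * J * star g.mat with hE
  have hstar : star E = E := by
    rw [hE, star_mul, star_mul, star_star, star_J, mul_assoc]
  let d : Fin 3 → ℝ := fun i => (E i i).re
  have hEd : E = Matrix.diagonal fun i => ((d i : ℝ) : ℍ[ℝ]) := by
    refine Matrix.ext fun i j => ?_
    by_cases hij : i = j
    · subst hij
      have h1 : star (E i i) = E i i := by rw [← Matrix.star_apply, hstar]
      rw [Matrix.diagonal_apply_eq]
      exact Quaternion.star_eq_self.1 h1
    · rw [Matrix.diagonal_apply_ne _ hij, hg i j hij]
  have hdet : ∏ i, d i ^ 2 = 1 := by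
    have h1 : studyDet E = 1 := by
      rw [hE, map_mul, map_mul, studyDet_star, G.studyDet_mat, studyDet_J]
      simp
    rw [hEd, studyDet_diagonal] at h1
    exact_mod_cast h1
  have hd : ∀ i, d i ≠ 0 := by
    intro i hi
    rw [Finset.prod_eq_zero (Finset.mem_univ i) (by rw [hi]; norm_num)] at hdet
    exact zero_ne_one hdet
  let a : Fin 3 → ℝ := fun i => (√|d i|)⁻¹
  have ha : ∀ i, 0 < a i := fun i => inv_pos.2 (Real.sqrt_pos.2 (abs_pos.2 (hd i)))
  have ha2 : ∀ i, a i ^ 2 = |d i|⁻¹ := fun i => by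
    rw [inv_pow, Real.sq_sqrt (abs_nonneg _)]
  have hinv : ∀ b b' : Fin 3 → ℝ, (∀ i, b i * b' i = 1) →
      (Matrix.diagonal fun i => ((b i : ℝ) : ℍ[ℝ])) *
        (Matrix.diagonal fun i => ((b' i : ℝ) : ℍ[ℝ])) = 1 := by
    intro b b' hb
    rw [Matrix.diagonal_mul_diagonal, ← Matrix.diagonal_one]
    congr 1
    funext i
    rw [← Quaternion.coe_mul, hb, Quaternion.coe_one]
  let c : G := mkG (Matrix.diagonal fun i => ((a i : ℝ) : ℍ[ℝ]))
    (Matrix.diagonal fun i => (((a i)⁻¹ : ℝ) : ℍ[ℝ]))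
    (hinv a (fun i => (a i)⁻¹) fun i => mul_inv_cancel₀ (ha i).ne')
    (hinv (fun i => (a i)⁻¹) a fun i => inv_mul_cancel₀ (ha i).ne')
    (by
      have h1 : ∏ i, |d i| = 1 := by
        rw [Finset.prod_pow] at hdet
        rw [← Finset.abs_prod]
        exact (pow_eq_one_iff_of_nonneg (abs_nonneg _) two_ne_zero).1 (by rwa [sq_abs])
      rw [studyDet_diagonal]
      simp only [ha2, Finset.prod_inv_distrib, h1]
      simp)
  refine ⟨c, fun i => a i * d i * a i, ?_, ?_, ?_⟩
  · intro v i j hij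
    have hne : i ≠ j := by rintro rfl; exact lt_irrefl _ hij
    exact ⟨Matrix.diagonal_apply_ne _ hne, Matrix.diagonal_apply_ne _ hne⟩
  · intro i
    have h1 : a i * d i * a i = d i / |d i| := by
      rw [mul_right_comm, ← sq, ha2, div_eq_inv_mul]
    simp only [h1]
    rcases lt_or_gt_of_ne (hd i) with h2 | h2
    · right; rw [abs_of_neg h2, div_neg, div_self (hd i)]
    · left; rw [abs_of_pos h2, div_self (hd i)]
  · have h1 : (c * g).mat * J * star (c * g).mat = c.mat * E * star c.mat := by
      rw [hE, G.mat_mul, star_mul]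
      simp only [mul_assoc]
    have h2 : c.mat = Matrix.diagonal fun i => ((a i : ℝ) : ℍ[ℝ]) := rfl
    rw [h1, h2, hEd, Matrix.star_eq_conjTranspose, Matrix.diagonal_conjTranspose,
      Matrix.diagonal_mul_diagonal, Matrix.diagonal_mul_diagonal]
    congr 1
    funext i
    simp

/-- Up to conjugation by `H`, a minimal `σ`-parabolic subgroup is a standard one, and the order of
the two negative basis vectors may be prescribed. -/
theorem exists_conj_stdParabolic_of_mem {P : Subgroup G} (hP : P ∈ minimalSigmaParabolics) :
    ∃ h ∈ H, ∃ w : Fin 3 → ℝ, Function.Injective w ∧ w 2 < w 1 ∧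
      P = conj h (stdParabolic w) := by
  obtain ⟨hmin, -, y, v, rfl, hσ⟩ := hP
  have hv := injective_of_minimal hmin
  obtain ⟨c, ε, hc, hε, hcy⟩ := exists_rescaling (g := y⁻¹) fun i j hij =>
    inv_mul_J_mul_star_inv_apply_eq_zero hv hσ hij
  set k := c * y⁻¹ with hk
  have hJ : (k⁻¹).mat * (Matrix.diagonal fun i => ((ε i : ℝ) : ℍ[ℝ])) * star (k⁻¹).mat = J := by
    rw [← hcy]
    simp only [mul_assoc, G.mat_inv_mul_mat_mul]
    rw [star_mat_mul_star_mat_inv, mul_one]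
  obtain ⟨i, hi⟩ := exists_pos hε hJ
  obtain ⟨π, hπ0, hπ⟩ := exists_perm hv i
  have hk1 : conj y (stdParabolic v) = conj k⁻¹ (stdParabolic v) := by
    have e : k⁻¹ = y * c⁻¹ := by rw [hk]; group
    rw [e, ← conj_conj, conj_stdParabolic_of_mem (inv_mem (hc v))]
  have hH : permElem π * k ∈ H := by
    rw [mem_H_iff']
    have e : (permElem π * k).mat * J * star (permElem π * k).mat =
        (permElem π).mat * (k.mat * J * star k.mat) * ((permElem π)⁻¹).mat := by
      rw [G.mat_mul, star_mul, star_permElem_mat]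
      simp only [mul_assoc]
    rw [e, hcy]
    refine Matrix.ext fun a b => ?_
    rw [permElem_mul_mul_inv, J_val]
    by_cases hab : a = b
    · subst hab
      rw [Matrix.diagonal_apply_eq, Matrix.diagonal_apply_eq]
      have hneg : ∀ a, a ≠ 0 → ε (π a) = -1 := fun a ha =>
        (hε _).resolve_left fun h1 => ha (π.injective (by
          rw [hπ0]; exact eq_of_pos_of_pos hcy h1 hi))
      fin_cases a
      · simp [hπ0, hi]
      · simp [hneg 1 (by decide)]
      · simp [hneg 2 (by decide)]
    · rw [Matrix.diagonal_apply_ne _ (π.injective.ne hab), Matrix.diagonal_apply_ne _ hab]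
  refine ⟨(permElem π * k)⁻¹, inv_mem hH, v ∘ π, hv.comp π.injective, hπ, ?_⟩
  rw [hk1, ← conj_permElem_stdParabolic, conj_conj]
  congr 1
  group

/-! ### Passage to the minimal `σ`-parabolic subgroups -/

theorem isRootExtension_Q₁_zero_one {w : Fin 3 → ℝ} (h01 : w 1 < w 0) (h12 : w 2 < w 1) :
    IsRootExtension w ![1, 1, 0] 0 1 where
  ne := by decide
  lt := h01
  eq := rfl
  le a b := by fin_cases a <;> fin_cases b <;> simp <;> linarith
  or a b h := by
    revert h
    fin_cases a <;> fin_cases b <;> simp <;>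
      first | linarith | (intro h; exfalso; linarith)

theorem isRootExtension_Q₁_one_zero {w : Fin 3 → ℝ} (h02 : w 2 < w 0) (h10 : w 0 < w 1) :
    IsRootExtension w ![1, 1, 0] 1 0 where
  ne := by decide
  lt := h10
  eq := rfl
  le a b := by fin_cases a <;> fin_cases b <;> simp <;> linarith
  or a b h := by
    revert h
    fin_cases a <;> fin_cases b <;> simp <;>
      first | linarith | (intro h; exfalso; linarith)

theorem isRootExtension_Q₄ {w : Fin 3 → ℝ} (h20 : w 0 < w 2) (h12 : w 2 < w 1) :
    IsRootExtension w ![0, 1, 0] 2 0 where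
  ne := by decide
  lt := h20
  eq := rfl
  le a b := by fin_cases a <;> fin_cases b <;> simp <;> linarith
  or a b h := by
    revert h
    fin_cases a <;> fin_cases b <;> simp <;>
      first | linarith | (intro h; exfalso; linarith)

theorem IsDivergentSchwartz.integralDiverges_stdRadical {φ : G ⧸ H → ℂ}
    (hφ : IsDivergentSchwartz φ) {w : Fin 3 → ℝ} (hw : Function.Injective w) (h12 : w 2 < w 1)
    (g : G) : IntegralDiverges φ (stdRadical w) g := by
  have h1 : ∀ g, IntegralDiverges φ (stdRadical ![1, 1, 0]) g := by
    have h := hφ.2.2 Q₁ ⟨1, one_mem _, Or.inl (conj_one _).symm⟩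
    rwa [Q₁, unipotentRadical_stdParabolic] at h
  have h4 : ∀ g, IntegralDiverges φ (stdRadical ![0, 1, 0]) g := by
    have h := hφ.2.2 Q₄ ⟨1, one_mem _, Or.inr (conj_one _).symm⟩
    rwa [Q₄, unipotentRadical_stdParabolic] at h
  have l1 := isPair_Q₁.locallyCompactSpace
  have l4 := isPair_Q₄.locallyCompactSpace
  rcases lt_or_gt_of_ne (hw.ne (show (0 : Fin 3) ≠ 2 by decide)) with h02 | h02
  · exact (isRootExtension_Q₄ h02 h12).integralDiverges hφ.1 h4 g
  · rcases lt_or_gt_of_ne (hw.ne (show (0 : Fin 3) ≠ 1 by decide)) with h01 | h01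
    · exact (isRootExtension_Q₁_one_zero h02 h01).integralDiverges hφ.1 h1 g
    · exact (isRootExtension_Q₁_zero_one h01 h12).integralDiverges hφ.1 h1 g

end SLThreeH

end

theorem corollary4p3 :
    (∃ φ : SLThreeH.G ⧸ SLThreeH.H → ℂ, SLThreeH.IsDivergentSchwartz φ) ∧
      ∀ φ : SLThreeH.G ⧸ SLThreeH.H → ℂ, SLThreeH.IsDivergentSchwartz φ →
        ∀ P ∈ SLThreeH.minimalSigmaParabolics, ∀ g : SLThreeH.G,
          SLThreeH.IntegralDiverges φ (SLThreeH.unipotentRadical P) g := by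
  refine ⟨⟨SLThreeH.witness, SLThreeH.isDivergentSchwartz_witness⟩, fun φ hφ P hP g => ?_⟩
  obtain ⟨h, hh, w, hw, hlt, rfl⟩ := SLThreeH.exists_conj_stdParabolic_of_mem hP
  rw [SLThreeH.unipotentRadical_conj, SLThreeH.unipotentRadical_stdParabolic,
    SLThreeH.integralDiverges_conj_iff hh]
  exact hφ.integralDiverges_stdRadical hw hlt _
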